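/- A continuum is a compact connected metric space with more than one point; a subcontinuum of a continuum $X$ is a nonempty closed connected subset of $X$ (one-point subsets are allowed). Let $2^X$ be the set of all nonempty closed subsets of $X$ with the Hausdorff metric, and let $NB(F_1(X))\subseteq 2^X$ be the subspace of all nonempty closed proper subsets $B\subsetneq X$ such that, for every point $p\in X\setminus B$, the union of all subcontinua of $X$ that contain $p$ and are contained in $X\setminus B$ is dense in $X$. Theorem 1.1. For every separable completely metrizable topological space $Z$ there is a continuum $X$ such that $NB(F_1(X))$ is homeomorphic to $Z$. -/

import Mathlib

open TopologicalSpace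

/-- For a set `B` in a topological space `X`, `B` does not block the point `p`: the union of all
subcontinua (closed connected nonempty subsets, one-point sets allowed) of `X` that contain `p`
and are contained in the complement of `B` is dense in `X`. -/
def DoesNotBlock {X : Type*} [TopologicalSpace X] (B : Set X) (p : X) : Prop :=
  Dense (⋃₀ {K : Set X | IsClosed K ∧ IsConnected K ∧ p ∈ K ∧ K ⊆ Bᶜ})

/-- The collection `NB(F₁(X))` of the nonempty proper closed subsets of the compact metric space
`X` that block no point of their complement. In a compact metric space the nonempty closed subsets
are the nonempty compact ones, so the hyperspace `2^X` is `NonemptyCompacts X`, on which Mathlib's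
metric is the Hausdorff metric; as a subset, `NonBlockers X` carries the subspace topology. -/
def NonBlockers (X : Type*) [MetricSpace X] [CompactSpace X] : Set (NonemptyCompacts X) :=
  {B | (B : Set X) ≠ Set.univ ∧ ∀ p ∈ (B : Set X)ᶜ, DoesNotBlock (B : Set X) p}

/-!
# Every Polish space is the space of non-blockers of the points of a continuum

Embed `Z` as a `Gδ` subset of the bottom face of a Hilbert cube. The continuum `X` is the cube with
further pieces attached, so that the closed sets blocking no point of their complement are exactly
the singletons of the points of `Z`. Three things are needed.

* A set with two points in `Z` must block. The points differ in some coordinate, and lie in two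
  opposite halves of the cube defined by it. For each of countably many pairs of halves, attach to
  the cube a line whose left end accumulates on one half and whose right end on the other. A
  continuum which contains a point of the line and leaves the line contains one of the two halves
  (`Attach.incl_subset_of_exits`), so the line is trapped by a set meeting both.
* A set with points outside `Z` must block. The part of the cube outside `Z`, together with the
  lines, is a union of countably many path-connected closed sets `F i`: since `Z` lies at height
  `0`, the complement of `Z` in the cube is a union of closed sets made path-connected by adding the
  slab of points of height at least `1 / (n + 1)`. To each `F i` attach a hereditarily
  indecomposable continuum `C` without a point `o`, winding along a ray dense in `F i` as `o` is
  approached. A continuum leaving such a piece contains `F i` (`Attach.incl_mem_of_exits`), so a set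
  meeting `F i` traps the piece. The points of the pieces themselves block by hereditary
  indecomposability (`Attach.subset_of_not_blocks`).
* A point of `Z` must not block. All points of the cube can be joined to its top face avoiding the
  given point, a line can be left through the end which does not accumulate there, and the other
  pieces lie over sets that miss it (`exists_base_continuum`, `doesNotBlock_singleton`).

A hereditarily indecomposable continuum is obtained as an inverse limit of arcs with crooked bonding
maps (`exists_hereditarilyIndecomposable`). Both kinds of pieces are instances of the construction
`Attach`.
-/

open Set Filter Topology
open scoped OnePoint unitInterval

/-! ### Crooked maps of the interval -/

/-- On `[a, b]` the function `f` returns, up to `ε`, first to its value at `b` and then to its value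
at `a`. -/
def CrookedOn (ε : ℝ) (f : ℝ → ℝ) (a b : ℝ) : Prop :=
  ∃ c d, a ≤ c ∧ c ≤ d ∧ d ≤ b ∧ dist (f c) (f b) ≤ ε ∧ dist (f d) (f a) ≤ ε

/-- `ε`-crookedness on every interval. Functions are defined on the whole line and the crooked ones
used below are constant outside a compact interval, so that no domain has to be tracked. -/
def Crooked (ε : ℝ) (f : ℝ → ℝ) : Prop :=
  ∀ a b, a ≤ b → CrookedOn ε f a b

theorem CrookedOn.mono {f : ℝ → ℝ} {ε a b a' b' : ℝ} (h : CrookedOn ε f a' b')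
    (ha : a ≤ a') (hb : b' ≤ b) (hfa : f a' = f a) (hfb : f b' = f b) : CrookedOn ε f a b := by
  obtain ⟨c, d, h1, h2, h3, h4, h5⟩ := h
  exact ⟨c, d, ha.trans h1, h2, h3.trans hb, hfb ▸ h4, hfa ▸ h5⟩

theorem exists_eq_of_between {f : ℝ → ℝ} (hf : Continuous f) {a b y : ℝ} (hab : a ≤ b)
    (h : f a ≤ y ∧ y ≤ f b ∨ f b ≤ y ∧ y ≤ f a) : ∃ c, a ≤ c ∧ c ≤ b ∧ f c = y := by
  rcases h with h | h
  · obtain ⟨c, hc, hy⟩ := intermediate_value_Icc hab hf.continuousOn h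
    exact ⟨c, hc.1, hc.2, hy⟩
  · obtain ⟨c, hc, hy⟩ := intermediate_value_Icc' hab hf.continuousOn h
    exact ⟨c, hc.1, hc.2, hy⟩

/-- `f` is a Lipschitz `1`-crooked function with values in `[0, n]` which is `0` on `(-∞, 0]` and
`n` on `[L, ∞)`. -/
structure IsCrookedRise (n L : ℝ) (f : ℝ → ℝ) : Prop where
  nonneg : 0 ≤ L
  lipschitz : ∃ K, LipschitzWith K f
  left : ∀ t ≤ 0, f t = 0
  right : ∀ t, L ≤ t → f t = n
  mem : ∀ t, 0 ≤ f t ∧ f t ≤ n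
  crooked : Crooked 1 f

/-- Climb from `0` to `n + 1` along `f`, descend to `1` along the reversed `g`, and climb to `n + 2`
along `f`. Since the functions are constant outside their intervals, this concatenation is a sum. -/
theorem IsCrookedRise.step {n L M : ℝ} {f g : ℝ → ℝ}
    (hg : IsCrookedRise n M g) (hf : IsCrookedRise (n + 1) L f) :
    IsCrookedRise (n + 2) (L + M + L)
      (fun t => f t + (g (L + M - t) - n) + f (t - (L + M))) := by
  set F : ℝ → ℝ := fun t => f t + (g (L + M - t) - n) + f (t - (L + M)) with hF
  have hL := hf.nonneg
  have hM := hg.nonneg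
  have F1 : ∀ t ≤ L, F t = f t := by
    intro t ht
    simp only [hF]
    rw [hg.right _ (by linarith), hf.left (t - (L + M)) (by linarith)]; ring
  have F2 : ∀ t, L ≤ t → t ≤ L + M → F t = 1 + g (L + M - t) := by
    intro t ht ht'
    simp only [hF]
    rw [hf.right _ ht, hf.left (t - (L + M)) (by linarith)]; ring
  have F3 : ∀ t, L + M ≤ t → F t = 1 + f (t - (L + M)) := by
    intro t ht
    simp only [hF]
    rw [hf.right t (by linarith), hg.left (L + M - t) (by linarith)]; ring
  have B1 : ∀ t ≤ L, 0 ≤ F t ∧ F t ≤ n + 1 := fun t ht => by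
    rw [F1 t ht]; exact hf.mem t
  have B2 : ∀ t, L ≤ t → t ≤ L + M → 1 ≤ F t ∧ F t ≤ n + 1 := fun t ht ht' => by
    rw [F2 t ht ht']; have := hg.mem (L + M - t); constructor <;> linarith
  have B3 : ∀ t, L + M ≤ t → 1 ≤ F t ∧ F t ≤ n + 2 := fun t ht => by
    rw [F3 t ht]; have := hf.mem (t - (L + M)); constructor <;> linarith
  have FL : F L = n + 1 := by rw [F1 L le_rfl, hf.right L le_rfl]
  have FM : F (L + M) = 1 := by rw [F3 _ le_rfl, hf.left _ (by linarith)]; ring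
  have lip : ∃ K, LipschitzWith K F := by
    obtain ⟨K, hK⟩ := hf.lipschitz
    obtain ⟨K', hK'⟩ := hg.lipschitz
    have h1 : LipschitzWith 1 (fun t : ℝ => L + M - t) := by
      apply LipschitzWith.of_dist_le_mul; intro x y
      simp only [Real.dist_eq, NNReal.coe_one, one_mul]
      rw [abs_sub_comm x y]; apply le_of_eq; congr 1; ring
    have h2 : LipschitzWith 1 (fun t : ℝ => t - (L + M)) := by
      apply LipschitzWith.of_dist_le_mul; intro x y
      simp only [Real.dist_eq, NNReal.coe_one, one_mul]
      apply le_of_eq; congr 1; ring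
    exact ⟨_, (hK.add ((hK'.comp h1).sub (LipschitzWith.const n))).add (hK.comp h2)⟩
  have Fc : Continuous F := by obtain ⟨K, hK⟩ := lip; exact hK.continuous
  have C1 : ∀ a b, a ≤ b → b ≤ L → CrookedOn 1 F a b := by
    intro a b hab hb
    obtain ⟨c, d, h1, h2, h3, h4, h5⟩ := hf.crooked a b hab
    refine ⟨c, d, h1, h2, h3, ?_, ?_⟩
    · rwa [F1 c (by linarith), F1 b hb]
    · rwa [F1 d (by linarith), F1 a (by linarith)]
  have C2 : ∀ a b, a ≤ b → L ≤ a → b ≤ L + M → CrookedOn 1 F a b := by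
    intro a b hab ha hb
    obtain ⟨c, d, h1, h2, h3, h4, h5⟩ := hg.crooked (L + M - b) (L + M - a) (by linarith)
    refine ⟨L + M - d, L + M - c, by linarith, by linarith, by linarith, ?_, ?_⟩
    · rw [F2 _ (by linarith) (by linarith), F2 b (by linarith) hb, dist_add_left]
      simpa using h5
    · rw [F2 _ (by linarith) (by linarith), F2 a ha (by linarith), dist_add_left]
      simpa using h4
  have C3 : ∀ a b, a ≤ b → L + M ≤ a → CrookedOn 1 F a b := by
    intro a b hab ha
    obtain ⟨c, d, h1, h2, h3, h4, h5⟩ := hf.crooked (a - (L + M)) (b - (L + M)) (by linarith)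
    refine ⟨c + (L + M), d + (L + M), by linarith, by linarith, by linarith, ?_, ?_⟩
    · rw [F3 _ (by linarith), F3 b (by linarith), dist_add_left]
      simpa using h4
    · rw [F3 _ (by linarith), F3 a (by linarith), dist_add_left]
      simpa using h5
  refine ⟨by linarith, lip, ?_, ?_, ?_, ?_⟩
  · intro t ht; rw [F1 t (by linarith), hf.left t ht]
  · intro t ht; rw [F3 t (by linarith), hf.right _ (by linarith)]; ring
  · intro t
    rcases le_total t L with h | h
    · have := B1 t h; constructor <;> linarith
    rcases le_total t (L + M) with h' | h'
    · have := B2 t h h'; constructor <;> linarith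
    · have := B3 t h'; constructor <;> linarith
  intro a b hab
  -- In all cases but one, the values at `a` and `b` are taken, in this order, within one piece
  -- between `a` and `b`, and that piece is crooked.
  rcases le_total b L with hb | hb
  · exact C1 a b hab hb
  rcases le_total (L + M) a with ha | ha
  · exact C3 a b hab ha
  rcases le_total a L with haL | haL
  · rcases le_total b (L + M) with hbM | hbM
    · rcases le_total (F a) (F b) with hv | hv
      · obtain ⟨b', h1, h2, h3⟩ := exists_eq_of_between Fc haL (y := F b)
          (Or.inl ⟨hv, by rw [FL]; exact (B2 b hb hbM).2⟩)
        exact (C1 a b' h1 h2).mono le_rfl (h2.trans hb) rfl h3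
      · obtain ⟨a', h1, h2, h3⟩ := exists_eq_of_between Fc hb (y := F a)
          (Or.inr ⟨hv, by rw [FL]; exact (B1 a haL).2⟩)
        exact (C2 a' b h2 h1 hbM).mono (haL.trans h1) le_rfl h3 rfl
    · rcases le_total (F a) (F b) with hv | hv
      · -- The exception: `c` is found in the first piece, and `d` in the third.
        have hc : ∃ c, a ≤ c ∧ c ≤ L ∧ dist (F c) (F b) ≤ 1 := by
          rcases le_total (F b) (n + 1) with h | h
          · obtain ⟨c, h1, h2, h3⟩ := exists_eq_of_between Fc haL (y := F b)
              (Or.inl ⟨hv, by rw [FL]; exact h⟩)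
            exact ⟨c, h1, h2, by simp [h3]⟩
          · refine ⟨L, haL, le_rfl, ?_⟩
            rw [FL, Real.dist_eq, abs_le]
            have := (B3 b hbM).2
            constructor <;> linarith
        have hd : ∃ d, L + M ≤ d ∧ d ≤ b ∧ dist (F d) (F a) ≤ 1 := by
          rcases le_total 1 (F a) with h | h
          · obtain ⟨d, h1, h2, h3⟩ := exists_eq_of_between Fc hbM (y := F a)
              (Or.inl ⟨by rw [FM]; exact h, hv⟩)
            exact ⟨d, h1, h2, by simp [h3]⟩
          · refine ⟨L + M, le_rfl, hbM, ?_⟩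
            rw [FM, Real.dist_eq, abs_le]
            have := (B1 a haL).1
            constructor <;> linarith
        obtain ⟨c, h1, h2, h3⟩ := hc
        obtain ⟨d, h4, h5, h6⟩ := hd
        exact ⟨c, d, h1, by linarith, h5, h3, h6⟩
      · have hb1 := (B3 b hbM).1
        obtain ⟨a', h1, h2, h3⟩ := exists_eq_of_between Fc (by linarith : L ≤ L + M) (y := F a)
          (Or.inr ⟨by rw [FM]; linarith, by rw [FL]; exact (B1 a haL).2⟩)
        obtain ⟨b', h4, h5, h6⟩ := exists_eq_of_between Fc h2 (y := F b)
          (Or.inr ⟨by rw [FM]; exact hb1, by rw [h3]; exact hv⟩)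
        exact (C2 a' b' h4 h1 h5).mono (haL.trans h1) (h5.trans hbM) h3 h6
  · rcases le_total b (L + M) with hbM | hbM
    · exact C2 a b hab haL hbM
    · rcases le_total (F a) (F b) with hv | hv
      · obtain ⟨a', h1, h2, h3⟩ := exists_eq_of_between Fc hbM (y := F a)
          (Or.inl ⟨by rw [FM]; exact (B2 a haL ha).1, hv⟩)
        exact (C3 a' b h2 h1).mono (ha.trans h1) le_rfl h3 rfl
      · obtain ⟨b', h1, h2, h3⟩ := exists_eq_of_between Fc ha (y := F b)
          (Or.inr ⟨by rw [FM]; exact (B3 b hbM).1, hv⟩)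
        exact (C2 a b' h1 haL h2).mono le_rfl (h2.trans hbM) rfl h3

/-- The induction runs over consecutive pairs, as `IsCrookedRise.step` uses the two previous
functions. -/
theorem exists_isCrookedRise (n : ℕ) :
    (∃ L f, IsCrookedRise n L f) ∧ ∃ L f, IsCrookedRise (n + 1) L f := by
  induction n with
  | zero =>
    refine ⟨⟨0, fun _ => 0, le_rfl, ⟨0, LipschitzWith.const 0⟩, by simp, by simp, by simp,
      fun a b h => ⟨a, b, le_rfl, h, le_rfl, by simp, by simp⟩⟩, ?_⟩
    refine ⟨1, fun t => max 0 (min 1 t), zero_le_one,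
      ⟨1, (LipschitzWith.id.const_min 1).const_max 0⟩, ?_, ?_, ?_, ?_⟩
    · intro t ht; exact max_eq_left ((min_le_right _ _).trans ht)
    · intro t ht; simp [min_eq_left ht]
    · intro t; simp
    · intro a b h
      have key : ∀ x y : ℝ, dist (max 0 (min 1 x)) (max 0 (min 1 y)) ≤ 1 := by
        intro x y
        rw [Real.dist_eq, abs_le]
        have h1 := le_max_left 0 (min 1 x)
        have h2 := le_max_left 0 (min 1 y)
        have h3 : max 0 (min 1 x) ≤ 1 := max_le zero_le_one (min_le_left _ _)
        have h4 : max 0 (min 1 y) ≤ 1 := max_le zero_le_one (min_le_left _ _)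
        constructor <;> linarith
      exact ⟨a, b, le_rfl, h, le_rfl, key _ _, key _ _⟩
  | succ n ih =>
    obtain ⟨⟨M, g, hg⟩, L, f, hf⟩ := ih
    have h := hg.step hf
    rw [show (n : ℝ) + 2 = (n + 1 : ℕ) + 1 by push_cast; ring] at h
    exact ⟨⟨L, f, by exact_mod_cast hf⟩, _, _, h⟩

/-- For every `ε > 0` there is an `ε`-crooked Lipschitz surjection of the unit interval fixing the
endpoints. -/
theorem exists_crooked {ε : ℝ} (hε : 0 < ε) : ∃ (K : NNReal) (f : ℝ → ℝ), 1 ≤ K ∧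
    LipschitzWith K f ∧ (∀ t ≤ 0, f t = 0) ∧ (∀ t, 1 ≤ t → f t = 1) ∧
    (∀ t, f t ∈ Icc (0 : ℝ) 1) ∧ Crooked ε f := by
  obtain ⟨n, hn⟩ := exists_nat_one_div_lt hε
  obtain ⟨L, f, hf⟩ := (exists_isCrookedRise n).2
  have hn0 : (0 : ℝ) < n + 1 := by positivity
  have hL : 0 < L := by
    rcases hf.nonneg.eq_or_lt with h | h
    · have h1 := hf.left 0 le_rfl
      have h2 := hf.right 0 h.symm.le
      linarith
    · exact h
  obtain ⟨K, hK⟩ := hf.lipschitz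
  have hlip : LipschitzWith (Real.toNNReal (1 / (n + 1)) * (K * Real.toNNReal L))
      (fun t => f (L * t) / (n + 1)) := by
    apply LipschitzWith.of_dist_le_mul
    intro x y
    have := hK.dist_le_mul (L * x) (L * y)
    have h2 : dist (L * x) (L * y) = L * dist x y := by
      rw [Real.dist_eq, Real.dist_eq, ← mul_sub, abs_mul, abs_of_pos hL]
    have h3 : dist (f (L * x) / (n + 1)) (f (L * y) / (n + 1)) =
        1 / (n + 1) * dist (f (L * x)) (f (L * y)) := by
      rw [Real.dist_eq, Real.dist_eq, ← sub_div, abs_div, abs_of_pos hn0]; ring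
    rw [h3]
    push_cast
    rw [Real.coe_toNNReal _ hL.le, Real.coe_toNNReal _ (by positivity), mul_assoc]
    apply mul_le_mul_of_nonneg_left _ (by positivity)
    rw [h2] at this
    linarith
  refine ⟨max 1 _, _, le_max_left _ _, hlip.weaken (le_max_right _ _), ?_, ?_, ?_, ?_⟩
  · intro t ht
    rw [hf.left _ (mul_nonpos_of_nonneg_of_nonpos hL.le ht), zero_div]
  · intro t ht
    rw [hf.right _ (le_mul_of_one_le_right hL.le ht), div_self hn0.ne']
  · intro t
    have := hf.mem (L * t)
    exact ⟨div_nonneg this.1 hn0.le, (div_le_one hn0).2 this.2⟩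
  · intro a b hab
    obtain ⟨c, d, h1, h2, h3, h4, h5⟩ := hf.crooked (L * a) (L * b)
      (mul_le_mul_of_nonneg_left hab hL.le)
    have key : ∀ x y, dist (f x) (f y) ≤ 1 → dist (f x / (n + 1)) (f y / (n + 1)) ≤ ε := by
      intro x y h
      rw [Real.dist_eq] at *
      rw [← sub_div, abs_div, abs_of_pos hn0]
      exact (div_le_div_of_nonneg_right h hn0.le).trans hn.le
    refine ⟨c / L, d / L, (le_div_iff₀ hL).2 (by linarith),
      div_le_div_of_nonneg_right h2 hL.le, (div_le_iff₀ hL).2 (by linarith), ?_, ?_⟩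
    · simp only [mul_div_cancel₀ _ hL.ne']; exact key _ _ h4
    · simp only [mul_div_cancel₀ _ hL.ne']; exact key _ _ h5

/-! ### A hereditarily indecomposable continuum -/

/-- Any two intersecting subcontinua of `X` are comparable by inclusion. For a compact Hausdorff `X`
this is hereditary indecomposability. -/
def HereditarilyIndecomposable (X : Type*) [TopologicalSpace X] : Prop :=
  ∀ A B : Set X, IsClosed A → IsClosed B → IsPreconnected A → IsPreconnected B →
    (A ∩ B).Nonempty → A ⊆ B ∨ B ⊆ A

theorem isPreconnected_iInter_of_antitone {X : Type*} [TopologicalSpace X] [T2Space X]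
    {K : ℕ → Set X} (hK : Antitone K) (hc : ∀ n, IsCompact (K n))
    (hp : ∀ n, IsPreconnected (K n)) : IsPreconnected (⋂ n, K n) := by
  have hcl : IsClosed (⋂ n, K n) := isClosed_iInter fun n => (hc n).isClosed
  have hcomp : IsCompact (⋂ n, K n) := (hc 0).of_isClosed_subset hcl (iInter_subset _ 0)
  rw [isPreconnected_closed_iff]
  intro A B hA hB hAB hnA hnB
  by_contra hne
  have hdis : Disjoint ((⋂ n, K n) ∩ A) ((⋂ n, K n) ∩ B) := by
    rw [Set.disjoint_left]
    intro x hx hx'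
    exact hne ⟨x, hx.1, hx.2, hx'.2⟩
  obtain ⟨U, V, hU, hV, hAU, hBV, hUV⟩ :=
    SeparatedNhds.of_isCompact_isCompact (hcomp.inter_right hA) (hcomp.inter_right hB) hdis
  obtain ⟨n, hn⟩ := exists_subset_nhds_of_isCompact (V := K) hK.directed_ge hc
    (U := U ∪ V) (fun x hx => by
      rcases hAB hx with h | h
      · exact (hU.union hV).mem_nhds (Or.inl (hAU ⟨hx, h⟩))
      · exact (hU.union hV).mem_nhds (Or.inr (hBV ⟨hx, h⟩)))
  obtain ⟨a, ha, haA⟩ := hnA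
  obtain ⟨b, hb, hbB⟩ := hnB
  obtain ⟨x, -, hxU, hxV⟩ := hp n U V hU hV hn ⟨a, mem_iInter.1 ha n, hAU ⟨ha, haA⟩⟩
    ⟨b, mem_iInter.1 hb n, hBV ⟨hb, hbB⟩⟩
  exact Set.disjoint_left.1 hUV hxU hxV

section InverseLimit

variable (h : ℕ → ℝ → ℝ)

/-- The sequences in `[0, 1]` which satisfy the first `n` of the relations `h k (x (k + 1)) = x k`.
-/
def partialThreads (n : ℕ) : Set (ℕ → ℝ) :=
  {x | (∀ k, x k ∈ Icc (0 : ℝ) 1) ∧ ∀ k < n, h k (x (k + 1)) = x k}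

/-- The inverse limit of the sequence of copies of `[0, 1]` with bonding maps `h k`. -/
def threads : Set (ℕ → ℝ) :=
  {x | (∀ k, x k ∈ Icc (0 : ℝ) 1) ∧ ∀ k, h k (x (k + 1)) = x k}

theorem threads_eq_iInter : threads h = ⋂ n, partialThreads h n := by
  ext x
  simp only [threads, partialThreads, Set.mem_ofPred_eq, mem_iInter]
  exact ⟨fun hx n => ⟨hx.1, fun k _ => hx.2 k⟩, fun hx => ⟨(hx 0).1, fun k =>
    (hx (k + 1)).2 k k.lt_succ_self⟩⟩

variable {h}

theorem isCompact_partialThreads (hc : ∀ n, Continuous (h n)) (n : ℕ) :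
    IsCompact (partialThreads h n) := by
  have h1 : IsCompact (univ.pi fun _ : ℕ => Icc (0 : ℝ) 1) :=
    isCompact_univ_pi fun _ => isCompact_Icc
  have h2 : IsClosed {x : ℕ → ℝ | ∀ k < n, h k (x (k + 1)) = x k} := by
    simp only [ofPred_forall]
    exact isClosed_iInter fun k => isClosed_iInter fun _ =>
      isClosed_eq ((hc k).comp (continuous_apply _)) (continuous_apply _)
  convert h1.inter_right h2 using 1
  ext x; simp only [partialThreads, Set.mem_ofPred_eq, mem_inter_iff, Set.mem_pi, mem_univ,
    true_imp_iff]

theorem exists_retraction_partialThreads (hc : ∀ n, Continuous (h n))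
    (hI : ∀ n t, h n t ∈ Icc (0 : ℝ) 1) (n : ℕ) :
    ∃ T : (ℕ → ℝ) → ℕ → ℝ, Continuous T ∧ (∀ x, ∀ k ≥ n, T x k = x k) ∧
      (∀ x, (∀ k, x k ∈ Icc (0 : ℝ) 1) → T x ∈ partialThreads h n) ∧
      ∀ x ∈ partialThreads h n, T x = x := by
  induction n with
  | zero => exact ⟨id, continuous_id, fun _ _ _ => rfl, fun x hx => ⟨hx, by simp⟩, fun _ _ => rfl⟩
  | succ n ih =>
    obtain ⟨T, hT, hT1, hT2, hT3⟩ := ih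
    refine ⟨fun x => T (Function.update x n (h n (x (n + 1)))), ?_, ?_, ?_, ?_⟩
    · exact hT.comp (continuous_id.update n ((hc n).comp (continuous_apply _)))
    · intro x k hk
      simp only
      rw [hT1 _ k (by omega), Function.update_of_ne (by omega)]
    · intro x hx
      have hx' : ∀ k, Function.update x n (h n (x (n + 1))) k ∈ Icc (0 : ℝ) 1 := by
        intro k
        rcases eq_or_ne k n with rfl | hk
        · rw [Function.update_self]; exact hI _ _
        · rw [Function.update_of_ne hk]; exact hx k
      refine ⟨(hT2 _ hx').1, fun k hk => ?_⟩
      rcases (Nat.lt_succ_iff.1 hk).eq_or_lt with rfl | hk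
      · simp only
        rw [hT1 _ _ (Nat.le_succ _), hT1 _ _ le_rfl, Function.update_self,
          Function.update_of_ne (by omega)]
      · exact (hT2 _ hx').2 k hk
    · intro x hx
      have : Function.update x n (h n (x (n + 1))) = x := by
        rw [hx.2 n n.lt_succ_self, Function.update_eq_self]
      simp only [this]
      exact hT3 x ⟨hx.1, fun k hk => hx.2 k (by omega)⟩

theorem isPreconnected_partialThreads (hc : ∀ n, Continuous (h n))
    (hI : ∀ n t, h n t ∈ Icc (0 : ℝ) 1) (n : ℕ) : IsPreconnected (partialThreads h n) := by
  obtain ⟨T, hT, -, hT2, hT3⟩ := exists_retraction_partialThreads hc hI n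
  have h1 : IsPreconnected (univ.pi fun _ : ℕ => Icc (0 : ℝ) 1) :=
    isPreconnected_univ_pi fun _ => isPreconnected_Icc
  convert h1.image T hT.continuousOn using 1
  ext x
  constructor
  · intro hx
    exact ⟨x, fun k _ => hx.1 k, hT3 x hx⟩
  · rintro ⟨y, hy, rfl⟩
    exact hT2 y fun k => hy k (mem_univ _)

theorem isCompact_threads (hc : ∀ n, Continuous (h n)) : IsCompact (threads h) := by
  rw [threads_eq_iInter]
  exact (isCompact_partialThreads hc 0).of_isClosed_subset
    (isClosed_iInter fun n => (isCompact_partialThreads hc n).isClosed) (iInter_subset _ 0)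

theorem isPreconnected_threads (hc : ∀ n, Continuous (h n))
    (hI : ∀ n t, h n t ∈ Icc (0 : ℝ) 1) : IsPreconnected (threads h) := by
  rw [threads_eq_iInter]
  refine isPreconnected_iInter_of_antitone (fun m n hmn x hx => ⟨hx.1, fun k hk =>
    hx.2 k (hk.trans_le hmn)⟩) (isCompact_partialThreads hc) (isPreconnected_partialThreads hc hI)

/-- If the bonding maps are Lipschitz, then so is each of the first `n + 1` coordinates of a thread
as a function of the `n`-th one, with the product `Λ n` of the constants. -/
theorem dist_threads_le {Λ : ℕ → ℝ} {K : ℕ → NNReal} (hK : ∀ n, LipschitzWith (K n) (h n))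
    (hK1 : ∀ n, 1 ≤ K n) (hΛ0 : Λ 0 = 1) (hΛ : ∀ n, Λ (n + 1) = Λ n * K n)
    {x y : ℕ → ℝ} (hx : x ∈ threads h) (hy : y ∈ threads h) (n : ℕ) :
    ∀ j ≤ n, dist (x j) (y j) ≤ Λ n * dist (x n) (y n) := by
  have hpos : ∀ n, 1 ≤ Λ n := by
    intro n
    induction n with
    | zero => exact hΛ0.ge
    | succ n ih =>
      rw [hΛ]
      exact one_le_mul_of_one_le_of_one_le ih (by exact_mod_cast hK1 n)
  induction n with
  | zero => intro j hj; obtain rfl : j = 0 := by omega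
            simp [hΛ0]
  | succ n ih =>
    intro j hj
    rcases hj.eq_or_lt with rfl | hj
    · exact le_mul_of_one_le_left dist_nonneg (hpos _)
    · refine (ih j (by omega)).trans ?_
      rw [hΛ, mul_assoc]
      refine mul_le_mul_of_nonneg_left ?_ (zero_le_one.trans (hpos n))
      rw [← hx.2 n, ← hy.2 n]
      exact (hK n).dist_le_mul _ _

end InverseLimit

theorem exists_forall_not_close {A : Set (ℕ → ℝ)} (hA : IsClosed A) {b : ℕ → ℝ} (hb : b ∉ A) :
    ∃ N, ∀ n ≥ N, ∀ x ∈ A, ¬ ∀ j ≤ n, dist (x j) (b j) ≤ 1 / ((n : ℝ) + 1) := by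
  by_contra! hcon
  choose m hm x hx hxb using hcon
  refine hb (hA.mem_of_tendsto (b := atTop) (f := x) ?_ (Eventually.of_forall hx))
  rw [tendsto_pi_nhds]
  intro j
  rw [tendsto_iff_dist_tendsto_zero]
  refine squeeze_zero' (Eventually.of_forall fun _ => dist_nonneg) ?_
    tendsto_one_div_add_atTop_nhds_zero_nat
  filter_upwards [eventually_ge_atTop j] with N hN
  refine (hxb N j (hN.trans (hm N))).trans ?_
  exact one_div_le_one_div_of_le (by positivity) (by have := hm N; gcongr)

/-- The inverse limit of a sequence of sufficiently crooked maps of the interval is hereditarily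
indecomposable. Let two intersecting subcontinua contain points `a ∉ B` and `b ∉ A`. If the
coordinate of `a` lies to the left of that of `b` at a late level, crookedness gives between them a
coordinate of a point close to `b`, followed by one of a point close to `a`; the first can only come
from `B`, the second only from `A`, against the convexity of the projection of `A`. -/
theorem exists_hereditarilyIndecomposable : ∃ C : Set (ℕ → ℝ), IsCompact C ∧ IsPreconnected C ∧
    C.Nontrivial ∧ HereditarilyIndecomposable C := by
  have hex : ∀ ε : ℝ, ∃ (K : NNReal) (f : ℝ → ℝ), 0 < ε → 1 ≤ K ∧
    LipschitzWith K f ∧ (∀ t ≤ 0, f t = 0) ∧ (∀ t, 1 ≤ t → f t = 1) ∧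
    (∀ t, f t ∈ Icc (0 : ℝ) 1) ∧ Crooked ε f := by
    intro ε
    by_cases hε : 0 < ε
    · obtain ⟨K, f, hf⟩ := exists_crooked hε
      exact ⟨K, f, fun _ => hf⟩
    · exact ⟨0, id, fun h' => absurd h' hε⟩
  choose K f hf using hex
  -- `Λ n` is a Lipschitz constant for the compositions of the first bonding maps; the `n`-th map is
  -- chosen so crooked that its compositions with them are still `1 / (n + 1)`-crooked.
  let Λ : ℕ → ℝ := fun n => Nat.rec 1 (fun n l => l * K (1 / ((n + 1) * l))) n
  have hΛ0 : Λ 0 = 1 := rfl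
  have hΛs : ∀ n, Λ (n + 1) = Λ n * K (1 / ((n + 1) * Λ n)) := fun n => rfl
  have hΛpos : ∀ n, 0 < Λ n := by
    intro n
    induction n with
    | zero => rw [hΛ0]; exact one_pos
    | succ n ih =>
      rw [hΛs]
      have h1 := (hf (1 / ((n + 1) * Λ n)) (by positivity)).1
      have : (1 : ℝ) ≤ K (1 / ((n + 1) * Λ n)) := by exact_mod_cast h1
      positivity
  have hδ : ∀ n : ℕ, 0 < 1 / (((n : ℝ) + 1) * Λ n) := fun n => by have := hΛpos n; positivity
  set h : ℕ → ℝ → ℝ := fun n => f (1 / ((n + 1) * Λ n)) with hh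
  have hlip : ∀ n, LipschitzWith (K (1 / ((n + 1) * Λ n))) (h n) := fun n => (hf _ (hδ n)).2.1
  have hc : ∀ n, Continuous (h n) := fun n => (hlip n).continuous
  have hI : ∀ n t, h n t ∈ Icc (0 : ℝ) 1 := fun n => (hf _ (hδ n)).2.2.2.2.1
  have hcr : ∀ n, Crooked (1 / ((n + 1) * Λ n)) (h n) := fun n => (hf _ (hδ n)).2.2.2.2.2
  refine ⟨threads h, isCompact_threads hc, isPreconnected_threads hc hI, ?_, ?_⟩
  · refine ⟨fun _ => 0, ⟨by simp, fun k => (hf _ (hδ k)).2.2.1 0 le_rfl⟩, fun _ => 1,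
      ⟨by simp, fun k => (hf _ (hδ k)).2.2.2.1 1 le_rfl⟩, fun h0 => ?_⟩
    exact zero_ne_one (congrFun h0 0)
  -- At late levels, the point of `A` cannot lie to the left of the point of `B`.
  have H : ∀ A B : Set (ℕ → ℝ), A ⊆ threads h → B ⊆ threads h → IsClosed A → IsClosed B →
      IsPreconnected A → IsPreconnected B → (A ∩ B).Nonempty → ∀ a ∈ A, a ∉ B → ∀ b ∈ B, b ∉ A →
      ∃ N, ∀ n ≥ N, ¬ a (n + 1) ≤ b (n + 1) := by
    intro A B hAt hBt hA hB hpA hpB hAB a ha haB b hb hbA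
    obtain ⟨N₁, hN₁⟩ := exists_forall_not_close hA hbA
    obtain ⟨N₂, hN₂⟩ := exists_forall_not_close hB haB
    refine ⟨max N₁ N₂, fun n hn hab => ?_⟩
    let π : (ℕ → ℝ) → ℝ := fun x => x (n + 1)
    have hπ : Continuous π := continuous_apply _
    have hPA := hpA.image π hπ.continuousOn
    have hPB := hpB.image π hπ.continuousOn
    have hU : (π '' A ∪ π '' B).OrdConnected := by
      obtain ⟨x, hxA, hxB⟩ := hAB
      exact (IsPreconnected.union (π x) (mem_image_of_mem π hxA) (mem_image_of_mem π hxB)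
        hPA hPB).ordConnected
    obtain ⟨c, d, h1, h2, h3, h4, h5⟩ := hcr n (a (n + 1)) (b (n + 1)) hab
    have hsub : Icc (π a) (π b) ⊆ π '' A ∪ π '' B :=
      hU.out (Or.inl ⟨a, ha, rfl⟩) (Or.inr ⟨b, hb, rfl⟩)
    have close : ∀ x ∈ threads h, ∀ y ∈ threads h,
        dist (h n (x (n + 1))) (h n (y (n + 1))) ≤ 1 / ((n + 1) * Λ n) →
        ∀ j ≤ n, dist (x j) (y j) ≤ 1 / ((n : ℝ) + 1) := by
      intro x hx y hy hxy j hj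
      rw [hx.2 n, hy.2 n] at hxy
      refine (dist_threads_le hlip (fun n => (hf _ (hδ n)).1) hΛ0 hΛs hx hy n j hj).trans ?_
      refine (mul_le_mul_of_nonneg_left hxy (hΛpos n).le).trans (le_of_eq ?_)
      have := hΛpos n
      field_simp
    have hcA : c ∉ π '' A := by
      rintro ⟨x, hx, rfl⟩
      exact hN₁ n (le_of_max_le_left hn) x hx (close x (hAt hx) b (hBt hb) h4)
    have hdB : d ∉ π '' B := by
      rintro ⟨x, hx, rfl⟩
      exact hN₂ n (le_of_max_le_right hn) x hx (close x (hBt hx) a (hAt ha) h5)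
    have hdA := (hsub ⟨h1.trans h2, h3⟩).resolve_right hdB
    exact hcA (hPA.ordConnected.out ⟨a, ha, rfl⟩ hdA ⟨h1, h2⟩)
  intro A B hA hB hpA hpB hAB
  have himg : ∀ S : Set (threads h), IsClosed S → IsClosed ((↑) '' S : Set (ℕ → ℝ)) := fun S hS =>
    ((isCompact_threads hc).isClosed.isClosedEmbedding_subtypeVal).isClosedMap S hS
  have hpre : ∀ S : Set (threads h), IsPreconnected S → IsPreconnected ((↑) '' S : Set (ℕ → ℝ)) :=
    fun S hS => hS.image _ continuous_subtype_val.continuousOn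
  have hmem : ∀ (S : Set (threads h)) (x : threads h), x ∉ S →
      (x : ℕ → ℝ) ∉ ((↑) '' S : Set (ℕ → ℝ)) := fun S x hx hx' =>
    hx (Subtype.val_injective.mem_set_image.1 hx')
  by_contra! hcon
  obtain ⟨a, ha, haB⟩ := not_subset.1 hcon.1
  obtain ⟨b, hb, hbA⟩ := not_subset.1 hcon.2
  obtain ⟨x, hxA, hxB⟩ := hAB
  have hsub : ∀ S : Set (threads h), ((↑) '' S : Set (ℕ → ℝ)) ⊆ threads h := by
    rintro S _ ⟨y, -, rfl⟩; exact y.2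
  obtain ⟨N₁, hN₁⟩ := H _ _ (hsub A) (hsub B) (himg A hA) (himg B hB) (hpre A hpA) (hpre B hpB)
    ⟨x, ⟨x, hxA, rfl⟩, ⟨x, hxB, rfl⟩⟩ a ⟨a, ha, rfl⟩ (hmem B a haB) b ⟨b, hb, rfl⟩ (hmem A b hbA)
  obtain ⟨N₂, hN₂⟩ := H _ _ (hsub B) (hsub A) (himg B hB) (himg A hA) (hpre B hpB) (hpre A hpA)
    ⟨x, ⟨x, hxB, rfl⟩, ⟨x, hxA, rfl⟩⟩ b ⟨b, hb, rfl⟩ (hmem A b hbA) a ⟨a, ha, rfl⟩ (hmem B a haB)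
  exact (le_total ((a : ℕ → ℝ) (max N₁ N₂ + 1)) ((b : ℕ → ℝ) (max N₁ N₂ + 1))).elim
    (hN₁ _ (le_max_left _ _)) (hN₂ _ (le_max_right _ _))

/-! ### Boundary bumping, dense rays, and completely metrizable subspaces -/

/-- Boundary bumping: the component of a point in the complement of a nonempty open subset of a
continuum reaches the closure of that set. -/
theorem exists_isPreconnected_meets_closure {X : Type*} [TopologicalSpace X] [CompactSpace X]
    [T2Space X] [PreconnectedSpace X] {V : Set X} (hV : IsOpen V) (hne : V.Nonempty) {b : X}
    (hb : b ∉ V) : ∃ D : Set X, IsClosed D ∧ IsPreconnected D ∧ b ∈ D ∧ Disjoint D V ∧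
      (D ∩ closure V).Nonempty := by
  have hVc : IsClosed Vᶜ := hV.isClosed_compl
  have : CompactSpace (Vᶜ : Set X) := isCompact_iff_compactSpace.1 hVc.isCompact
  let b' : (Vᶜ : Set X) := ⟨b, hb⟩
  refine ⟨(↑) '' connectedComponent b', hVc.isClosedEmbedding_subtypeVal.isClosedMap _
    isClosed_connectedComponent, isPreconnected_connectedComponent.image _
    continuous_subtype_val.continuousOn, ⟨b', mem_connectedComponent, rfl⟩, ?_, ?_⟩
  · rw [Set.disjoint_left]
    rintro _ ⟨x, -, rfl⟩
    exact x.2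
  by_contra hcon
  -- Otherwise a clopen neighbourhood of the component misses `closure V`, and is clopen in `X`.
  let S : Set (Vᶜ : Set X) := {x | (x : X) ∈ closure V}
  have hS : IsClosed S := isClosed_closure.preimage continuous_subtype_val
  have hdis : connectedComponent b' ⊆ Sᶜ := fun x hx hxS => hcon ⟨x, ⟨x, hx, rfl⟩, hxS⟩
  rw [connectedComponent_eq_iInter_isClopen] at hdis
  have : Nonempty {s : Set (Vᶜ : Set X) // IsClopen s ∧ b' ∈ s} := ⟨⟨univ, isClopen_univ, trivial⟩⟩
  obtain ⟨⟨s, hs, hbs⟩, hsS⟩ := exists_subset_nhds_of_isCompact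
    (V := fun s : {s : Set (Vᶜ : Set X) // IsClopen s ∧ b' ∈ s} => (s : Set (Vᶜ : Set X)))
    (fun s t => ⟨⟨s ∩ t, s.2.1.inter t.2.1, s.2.2, t.2.2⟩, inter_subset_left, inter_subset_right⟩)
    (fun s => s.2.1.1.isCompact) (U := Sᶜ) (fun x hx => hS.isOpen_compl.mem_nhds (hdis hx))
  have hclosed : IsClosed ((↑) '' s : Set X) := hVc.isClosedEmbedding_subtypeVal.isClosedMap _ hs.1
  have hopen : IsOpen ((↑) '' s : Set X) := by
    obtain ⟨O, hO, hOs⟩ := isOpen_induced_iff.1 hs.2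
    have : ((↑) '' s : Set X) = O ∩ (closure V)ᶜ := by
      ext x
      constructor
      · rintro ⟨y, hy, rfl⟩
        refine ⟨by rw [← hOs] at hy; exact hy, hsS hy⟩
      · rintro ⟨hxO, hxV⟩
        refine ⟨⟨x, fun h => hxV (subset_closure h)⟩, ?_, rfl⟩
        rw [← hOs]; exact hxO
    rw [this]; exact hO.inter isClosed_closure.isOpen_compl
  have huniv := IsClopen.eq_univ ⟨hclosed, hopen⟩ ⟨b, b', hbs, rfl⟩
  obtain ⟨v, hv⟩ := hne
  obtain ⟨y, -, hy⟩ : v ∈ ((↑) '' s : Set X) := huniv ▸ mem_univ v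
  exact y.2 (hy ▸ hv)

/-- Infinitely many paths, placed end to end, form a path parametrized by the line. -/
theorem exists_continuous_through {Y : Type*} [TopologicalSpace Y] (y : ℤ → Y) (S : ℤ → Set Y)
    (hS : ∀ n, JoinedIn (S n) (y n) (y (n + 1))) :
    ∃ f : ℝ → Y, Continuous f ∧ (∀ n : ℤ, f n = y n) ∧
      ∀ (n : ℤ) (t : ℝ), n ≤ t → t ≤ n + 1 → f t ∈ S n := by
  let p : ∀ n, Path (y n) (y (n + 1)) := fun n => (hS n).somePath
  let f : ℝ → Y := fun t => (p ⌊t⌋).extend (t - ⌊t⌋)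
  have hfn : ∀ n : ℤ, f n = y n := fun n => by
    simp only [f, Int.floor_intCast, sub_self, Path.extend_zero]
  have key : ∀ (n : ℤ) (t : ℝ), n ≤ t → t ≤ n + 1 → f t = (p n).extend (t - n) := by
    intro n t h1 h2
    rcases h2.eq_or_lt with rfl | h2
    · have : f ((n : ℝ) + 1) = y (n + 1) := by exact_mod_cast hfn (n + 1)
      rw [this, add_sub_cancel_left, Path.extend_one]
    · have : ⌊t⌋ = n := Int.floor_eq_iff.2 ⟨h1, h2⟩
      simp only [f]
      rw [this]
  refine ⟨f, ?_, hfn, ?_⟩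
  · have hlf : LocallyFinite fun n : ℤ => Icc (n : ℝ) (n + 1) := by
      intro x
      refine ⟨Ioo (x - 1) (x + 1), Ioo_mem_nhds (by linarith) (by linarith),
        (Set.finite_Icc (⌊x⌋ - 2) (⌊x⌋ + 2)).subset ?_⟩
      rintro n ⟨t, ⟨h1, h2⟩, h3, h4⟩
      have h5 := Int.floor_le x
      have h6 := Int.lt_floor_add_one x
      constructor
      · have : ((⌊x⌋ - 2 : ℤ) : ℝ) ≤ n := by push_cast; linarith
        exact_mod_cast this
      · have : (n : ℝ) ≤ (⌊x⌋ + 2 : ℤ) := by push_cast; linarith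
        exact_mod_cast this
    refine hlf.continuous ?_ (fun _ => isClosed_Icc) fun n => ?_
    · exact eq_univ_of_forall fun t =>
        mem_iUnion.2 ⟨⌊t⌋, Int.floor_le t, (Int.lt_floor_add_one t).le⟩
    · refine ContinuousOn.congr (f := fun t => (p n).extend (t - n)) ?_
        fun t ht => key n t ht.1 ht.2
      exact ((p n).continuous_extend.comp (continuous_id.sub continuous_const)).continuousOn
  · intro n t h1 h2
    rw [key n t h1 h2, Path.extend_apply _ ⟨by linarith, by linarith⟩]
    exact (hS n).somePath_mem _

theorem exists_seq_mapClusterPt {Y : Type*} [TopologicalSpace Y] [SecondCountableTopology Y]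
    {F : Set Y} (hF : F.Nonempty) :
    ∃ y : ℕ → Y, (∀ n, y n ∈ F) ∧ ∀ x ∈ F, MapClusterPt x atTop y := by
  have : Nonempty F := hF.to_subtype
  refine ⟨fun n => denseSeq F n.unpair.1, fun n => (denseSeq F n.unpair.1).2, fun x hx => ?_⟩
  rw [mapClusterPt_iff_frequently]
  intro s hs
  rw [frequently_atTop]
  intro N
  obtain ⟨U, hUs, hU, hxU⟩ := mem_nhds_iff.1 hs
  obtain ⟨_, hv, ⟨m, rfl⟩⟩ := (denseRange_denseSeq F).inter_open_nonempty ((↑) ⁻¹' U : Set F)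
    (hU.preimage continuous_subtype_val) ⟨⟨x, hx⟩, mem_preimage.2 hxU⟩
  refine ⟨Nat.pair m N, Nat.right_le_pair _ _, hUs ?_⟩
  simpa using hv

/-- A path-connected set carries a ray each tail of which is dense in the set. -/
theorem IsPathConnected.exists_ray {Y : Type*} [TopologicalSpace Y] [SecondCountableTopology Y]
    {F : Set Y} (hF : IsPathConnected F) : ∃ f : ℝ → Y, Continuous f ∧ (∀ t, f t ∈ F) ∧
      ∀ x ∈ F, MapClusterPt x atTop f := by
  obtain ⟨y, hy, hcl⟩ := exists_seq_mapClusterPt hF.nonempty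
  obtain ⟨f, hf, hfn, hfS⟩ := exists_continuous_through (fun n : ℤ => y n.toNat) (fun _ => F)
    (fun n => hF.joinedIn _ (hy _) _ (hy _))
  refine ⟨f, hf, fun t => hfS ⌊t⌋ t (Int.floor_le t) (Int.lt_floor_add_one t).le, fun x hx => ?_⟩
  have h := hcl x hx
  have he : y = f ∘ fun n : ℕ => (n : ℝ) := by
    funext n; simpa using (hfn n).symm
  rw [he] at h
  exact h.of_comp tendsto_natCast_atTop_atTop

/-- A completely metrizable subspace of a metrizable space is a `Gδ`. -/
theorem Topology.IsEmbedding.isGδ_range {Z H : Type*} [MetricSpace Z] [CompleteSpace Z]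
    [TopologicalSpace H] [MetrizableSpace H] {e : Z → H} (he : IsEmbedding e) :
    IsGδ (range e) := by
  let V : ℕ → Set H := fun n =>
    ⋃₀ {U | IsOpen U ∧ ∀ z z', e z ∈ U → e z' ∈ U → dist z z' < 1 / ((n : ℝ) + 1)}
  have hV : ∀ n, IsOpen (V n) := fun n => isOpen_sUnion fun U hU => hU.1
  have heq : range e = closure (range e) ∩ ⋂ n, V n := by
    refine subset_antisymm ?_ ?_
    · rintro _ ⟨z, rfl⟩
      refine ⟨subset_closure ⟨z, rfl⟩, mem_iInter.2 fun n => ?_⟩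
      obtain ⟨U, hU, hUe⟩ := he.isOpen_iff.1
        (Metric.isOpen_ball (x := z) (ε := 1 / ((n : ℝ) + 1) / 2))
      have hmem : ∀ w, e w ∈ U ↔ dist w z < 1 / ((n : ℝ) + 1) / 2 := fun w => by
        rw [← mem_preimage, hUe, Metric.mem_ball]
      refine ⟨U, ⟨hU, fun w w' hw hw' => ?_⟩, (hmem z).2 (by rw [dist_self]; positivity)⟩
      have := dist_triangle_right w w' z
      have h1 := (hmem w).1 hw
      have h2 := (hmem w').1 hw'
      linarith
    · rintro x ⟨hx, hxV⟩
      have hne : (comap e (𝓝 x)).NeBot := comap_neBot fun t ht => by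
        obtain ⟨_, ht, z, rfl⟩ := mem_closure_iff_nhds.1 hx t ht
        exact ⟨z, ht⟩
      have hcau : Cauchy (comap e (𝓝 x)) := by
        refine Metric.cauchy_iff.2 ⟨hne, fun ε hε => ?_⟩
        obtain ⟨n, hn⟩ := exists_nat_one_div_lt hε
        obtain ⟨U, ⟨hU, hUd⟩, hxU⟩ := mem_iInter.1 hxV n
        exact ⟨e ⁻¹' U, preimage_mem_comap (hU.mem_nhds hxU), fun z hz z' hz' =>
          (hUd z z' hz hz').trans hn⟩
      obtain ⟨z, hz⟩ := CompleteSpace.complete hcau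
      have h1 : Tendsto e (comap e (𝓝 x)) (𝓝 (e z)) := (he.continuous.tendsto z).mono_left hz
      exact ⟨z, tendsto_nhds_unique h1 tendsto_comap⟩
  rw [heq]
  let _ := metrizableSpaceMetric H
  exact isClosed_closure.isGδ.inter (IsGδ.iInter_of_isOpen hV)

/-! ### Attaching pieces to a space -/

section Attach

variable {ι Y C : Type*}

/-- The set underlying `Attach`. -/
def attachSet (o : C) (g : ι → C → Y) : Set (Y × (ι → C)) :=
  {x | ∀ i, x.2 i ≠ o → x.1 = g i (x.2 i) ∧ ∀ j ≠ i, x.2 j = o}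

/-- The space obtained from `Y` by attaching, for each `i`, a copy of `C ∖ {o}` along the map `g i`:
a point at `c` of the `i`-th copy tends to `Y` as `c` tends to `o`, following `g i c`. It is
realized in `Y × (ι → C)` by the points `(y, (o, o, …))` and the points `(g i c, (o, …, o, c, o,
…))` with `c` at the place `i`. The product topology makes the attached pieces small outside `Y`
when `ι` is infinite, and the set is closed, whence compactness and metrizability. -/
abbrev Attach (o : C) (g : ι → C → Y) : Type _ := attachSet o g

namespace Attach

variable {o : C} {g : ι → C → Y}

/-- The retraction onto `Y`. -/
def base (x : Attach o g) : Y := x.1.1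

/-- The map onto `C` which collapses everything outside the `i`-th piece to `o`. -/
def coord (i : ι) (x : Attach o g) : C := x.1.2 i

/-- The inclusion of `Y`. -/
def incl (o : C) (g : ι → C → Y) (y : Y) : Attach o g := ⟨(y, fun _ => o), fun _ h => absurd rfl h⟩

open Classical in
/-- The point at `c` of the `i`-th piece. For `c = o` this is the point `g i o` of `Y`, whose value
has no meaning. -/
noncomputable def piece (o : C) (g : ι → C → Y) (i : ι) (c : C) : Attach o g :=
  ⟨(g i c, Function.update (fun _ => o) i c), fun j hj => by
    rcases eq_or_ne j i with rfl | hji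
    · refine ⟨by simp, fun k hk => by simp [hk]⟩
    · simp [hji] at hj⟩

@[simp] theorem base_incl (y : Y) : base (incl o g y) = y := rfl
@[simp] theorem coord_piece_self (i : ι) (c : C) : coord i (piece o g i c) = c := by
  simp [coord, piece]
theorem coord_piece_of_ne {i j : ι} (h : j ≠ i) (c : C) : coord j (piece o g i c) = o := by
  simp [coord, piece, h]

theorem incl_injective : Function.Injective (incl o g) :=
  Function.LeftInverse.injective (g := base) base_incl

theorem ext {x y : Attach o g} (h : base x = base y) (h' : ∀ i, coord i x = coord i y) : x = y :=
  Subtype.ext (Prod.ext h (funext h'))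

theorem eq_piece {i : ι} {x : Attach o g} (h : coord i x ≠ o) : x = piece o g i (coord i x) := by
  refine ext (x.2 i h).1 fun j => ?_
  rcases eq_or_ne j i with rfl | hj
  · simp
  · rw [coord_piece_of_ne hj]; exact (x.2 i h).2 j hj

theorem eq_incl {x : Attach o g} (h : ∀ i, coord i x = o) : x = incl o g (base x) := ext rfl h

theorem eq_of_coord_eq {i : ι} {x y : Attach o g} (h : coord i x ≠ o)
    (hxy : coord i x = coord i y) : x = y := by
  exact (eq_piece h).trans (hxy ▸ (eq_piece (hxy ▸ h)).symm)

theorem eq_incl_or_piece (x : Attach o g) :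
    (∃ y, x = incl o g y) ∨ ∃ i c, c ≠ o ∧ x = piece o g i c := by
  by_cases h : ∀ i, coord i x = o
  · exact Or.inl ⟨_, eq_incl h⟩
  · push Not at h
    obtain ⟨i, hi⟩ := h
    exact Or.inr ⟨i, _, hi, eq_piece hi⟩

/-- The points which lie over `F` and, if they are outside `Y`, belong to the part of the `i`-th
piece with coordinate in `M`. -/
def thick (o : C) (g : ι → C → Y) (i : ι) (M : Set C) (F : Set Y) : Set (Attach o g) :=
  {x | base x ∈ F ∧ coord i x ∈ M ∧ ∀ j ≠ i, coord j x = o}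

theorem piece_mem_thick {i : ι} {M : Set C} {F : Set Y} {c : C} (hc : c ∈ M) (hF : g i c ∈ F) :
    piece o g i c ∈ thick o g i M F :=
  ⟨hF, by simpa using hc, fun _ hj => coord_piece_of_ne hj c⟩

theorem incl_mem_thick {i : ι} {M : Set C} {F : Set Y} {y : Y} (ho : o ∈ M) (hy : y ∈ F) :
    incl o g y ∈ thick o g i M F :=
  ⟨hy, ho, fun _ _ => rfl⟩

theorem eq_incl_of_mem_thick {i : ι} {M : Set C} {F : Set Y} {x : Attach o g}
    (hx : x ∈ thick o g i M F) (hxo : coord i x = o) : x = incl o g (base x) :=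
  eq_incl fun j => by
    rcases eq_or_ne j i with rfl | hj
    exacts [hxo, hx.2.2 j hj]

variable [TopologicalSpace Y] [TopologicalSpace C]

theorem continuous_base : Continuous (base : Attach o g → Y) :=
  continuous_fst.comp continuous_subtype_val

theorem continuous_coord (i : ι) : Continuous (coord i : Attach o g → C) :=
  (continuous_apply i).comp (continuous_snd.comp continuous_subtype_val)

theorem continuous_incl : Continuous (incl o g) :=
  (continuous_id.prodMk continuous_const).subtype_mk _

theorem continuousOn_piece (hg : ∀ i, ContinuousOn (g i) {o}ᶜ) (i : ι) :
    ContinuousOn (piece o g i) {o}ᶜ := by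
  classical
  rw [Topology.IsInducing.subtypeVal.continuousOn_iff]
  refine (hg i).prodMk (Continuous.continuousOn ?_)
  exact continuous_const.update i continuous_id

theorem tendsto_piece {α : Type*} {l : Filter α} {i : ι} {u : α → C} {y : Y}
    (hu : Tendsto u l (𝓝 o)) (hy : Tendsto (fun t => g i (u t)) l (𝓝 y)) :
    Tendsto (fun t => piece o g i (u t)) l (𝓝 (incl o g y)) := by
  classical
  rw [Topology.IsInducing.subtypeVal.tendsto_nhds_iff]
  refine hy.prodMk_nhds (tendsto_pi_nhds.2 fun j => ?_)
  rcases eq_or_ne j i with rfl | hj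
  · simpa [Function.update_self] using hu
  · simpa [Function.update_of_ne hj] using tendsto_const_nhds

theorem isOpen_coord_ne [T1Space C] (i : ι) : IsOpen {x : Attach o g | coord i x ≠ o} :=
  isOpen_compl_singleton.preimage (continuous_coord i)

theorem compactSpace [T2Space Y] [T2Space C] [CompactSpace Y] [CompactSpace C]
    (hg : ∀ i, ContinuousOn (g i) {o}ᶜ) : CompactSpace (Attach o g) := by
  refine isCompact_iff_compactSpace.1 (IsClosed.isCompact ?_)
  have h1 : ∀ i, Continuous fun x : Y × (ι → C) => x.2 i := fun i =>
    (continuous_apply i).comp continuous_snd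
  have hO : ∀ i, IsOpen {x : Y × (ι → C) | x.2 i ≠ o} := fun i =>
    isOpen_compl_singleton.preimage (h1 i)
  rw [← isOpen_compl_iff]
  have : (attachSet o g)ᶜ =
      ⋃ i, ({x | x.2 i ≠ o} ∩ (fun x => (x.1, g i (x.2 i))) ⁻¹' {p | p.1 ≠ p.2}) ∪
        ⋃ j, ⋃ (_ : j ≠ i), {x | x.2 i ≠ o} ∩ {x | x.2 j ≠ o} := by
    ext x
    simp only [attachSet, mem_compl_iff, Set.mem_ofPred_eq, not_forall, mem_iUnion, mem_union,
      mem_inter_iff, mem_preimage, exists_prop, not_and_or]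
    refine exists_congr fun i => ?_
    constructor
    · rintro ⟨h, h' | ⟨j, hj, h'⟩⟩
      · exact Or.inl ⟨h, h'⟩
      · exact Or.inr ⟨j, hj, h, h'⟩
    · rintro (⟨h, h'⟩ | ⟨j, hj, h, h'⟩)
      · exact ⟨h, Or.inl h'⟩
      · exact ⟨h, Or.inr ⟨j, hj, h'⟩⟩
  rw [this]
  refine isOpen_iUnion fun i => IsOpen.union ?_ ?_
  · refine ContinuousOn.isOpen_inter_preimage ?_ (hO i) ?_
    · exact continuous_fst.continuousOn.prodMk ((hg i).comp (h1 i).continuousOn fun x hx => hx)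
    · exact isClosed_diagonal.isOpen_compl
  · exact isOpen_iUnion fun j => isOpen_iUnion fun _ => (hO i).inter (hO j)

/-- The map `coord i` is injective outside its fibre over `o`, so connectedness of a closed set can
be checked on its image and on the fibre over `o`. -/
theorem isPreconnected_of_coord [CompactSpace (Attach o g)] [T2Space C] {i : ι}
    {W : Set (Attach o g)} (hW : IsClosed W) (hM : IsPreconnected (coord i '' W))
    (hF : IsPreconnected (W ∩ {x | coord i x = o})) : IsPreconnected W := by
  rw [isPreconnected_closed_iff]
  intro A B hA hB hAB ⟨a, haW, haA⟩ ⟨b, hbW, hbB⟩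
  have himg : ∀ S : Set (Attach o g), IsClosed S → IsClosed (coord i '' S) := fun S hS =>
    (continuous_coord i).isClosedMap S hS
  obtain ⟨c, -, ⟨x, ⟨hxW, hxA⟩, hx⟩, ⟨y, ⟨hyW, hyB⟩, hy⟩⟩ :=
    isPreconnected_closed_iff.1 hM _ _ (himg _ (hW.inter hA)) (himg _ (hW.inter hB))
    (by rw [← image_union, ← inter_union_distrib_left]
        exact image_mono (subset_inter subset_rfl hAB))
    ⟨_, mem_image_of_mem _ haW, mem_image_of_mem _ ⟨haW, haA⟩⟩
    ⟨_, mem_image_of_mem _ hbW, mem_image_of_mem _ ⟨hbW, hbB⟩⟩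
  by_cases hc : c = o
  · obtain ⟨z, hz, hzAB⟩ := isPreconnected_closed_iff.1 hF A B hA hB (inter_subset_left.trans hAB)
      ⟨x, ⟨hxW, hx.trans hc⟩, hxA⟩ ⟨y, ⟨hyW, hy.trans hc⟩, hyB⟩
    exact ⟨z, hz.1, hzAB⟩
  · have : x = y := eq_of_coord_eq (by rw [hx]; exact hc) (hx.trans hy.symm)
    exact ⟨x, hxW, hxA, this ▸ hyB⟩

theorem isClosed_thick [T1Space C] {i : ι} {M : Set C} {F : Set Y} (hM : IsClosed M)
    (hF : IsClosed F) : IsClosed (thick o g i M F) := by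
  have h : IsClosed {x : Attach o g | ∀ j ≠ i, coord j x = o} := by
    simp only [ofPred_forall]
    exact isClosed_iInter fun j => isClosed_iInter fun _ =>
      isClosed_singleton.preimage (continuous_coord j)
  exact (hF.preimage continuous_base).inter ((hM.preimage (continuous_coord i)).inter h)

theorem isConnected_thick [CompactSpace (Attach o g)] [T2Space C] {i : ι} {M : Set C} {F : Set Y}
    (hM : IsClosed M) (hF : IsClosed F) (hMc : IsPreconnected M) (hFc : IsConnected F)
    (ho : o ∈ M) (hg : ∀ c ∈ M, c ≠ o → g i c ∈ F) : IsConnected (thick o g i M F) := by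
  obtain ⟨y, hy⟩ := hFc.nonempty
  refine ⟨⟨incl o g y, incl_mem_thick ho hy⟩,
    isPreconnected_of_coord (i := i) (isClosed_thick hM hF) ?_ ?_⟩
  · convert hMc using 1
    refine subset_antisymm (image_subset_iff.2 fun x hx => hx.2.1) fun c hc => ?_
    by_cases hco : c = o
    · exact ⟨incl o g y, incl_mem_thick ho hy, by rw [hco]; rfl⟩
    · exact ⟨piece o g i c, piece_mem_thick hc (hg c hc hco), by simp⟩
  · convert hFc.isPreconnected.image (incl o g) continuous_incl.continuousOn using 1
    ext x
    constructor
    · rintro ⟨h, h'⟩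
      exact ⟨base x, h.1, (eq_incl_of_mem_thick h h').symm⟩
    · rintro ⟨y, hy, rfl⟩
      exact ⟨incl_mem_thick ho hy, rfl⟩

end Attach

end Attach

/-! ### Attaching hereditarily indecomposable continua -/

namespace Attach

variable {ι Y C : Type*} [TopologicalSpace Y] [MetricSpace C]

/-- The attaching map which makes the piece `C ∖ {o}` wind along the ray `f i`, the parameter
tending to infinity at `o`. -/
noncomputable def spiral (o : C) (f : ι → ℝ → Y) (i : ι) (c : C) : Y := f i (dist c o)⁻¹

theorem continuousOn_spiral (o : C) {f : ι → ℝ → Y} (hf : ∀ i, Continuous (f i)) (i : ι) :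
    ContinuousOn (spiral o f i) {o}ᶜ :=
  (hf i).comp_continuousOn (ContinuousOn.inv₀ (by fun_prop) fun _ hc => dist_ne_zero.2 hc)

/-- A continuum which leaves the `i`-th piece projects to a continuum of `C` through `o`, on which
the distance to `o` takes all small values. So it follows the whole ray near infinity, and contains
all cluster points of the ray. -/
theorem incl_mem_of_exits {o : C} {f : ι → ℝ → Y} {i : ι} {N : Set (Attach o (spiral o f))}
    (hN : IsClosed N) (hNc : IsPreconnected N) {p q : Attach o (spiral o f)} (hp : p ∈ N)
    (hq : q ∈ N) (hpo : coord i p ≠ o) (hqo : coord i q = o) {y : Y}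
    (hy : MapClusterPt y atTop (f i)) : incl o (spiral o f) y ∈ N := by
  have hδ : 0 < dist (coord i p) o := dist_pos.2 hpo
  have hM := (hNc.image (fun x => dist (coord i x) o)
    ((continuous_coord i).dist continuous_const).continuousOn).ordConnected
  have hex : ∀ t : ℝ, ∃ c : C, (dist (coord i p) o)⁻¹ ≤ t →
      piece o (spiral o f) i c ∈ N ∧ dist c o = t⁻¹ := by
    intro t
    by_cases ht : (dist (coord i p) o)⁻¹ ≤ t
    · have ht0 : 0 < t := (inv_pos.2 hδ).trans_le ht
      obtain ⟨x, hxN, hx⟩ := hM.out (mem_image_of_mem _ hq) (mem_image_of_mem _ hp)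
        (⟨by simp only [hqo, dist_self]; positivity, inv_le_of_inv_le₀ hδ ht⟩ :
          t⁻¹ ∈ Icc (dist (coord i q) o) (dist (coord i p) o))
      have hxo : coord i x ≠ o := fun h => by
        simp only [h, dist_self] at hx
        exact (inv_pos.2 ht0).ne hx
      exact ⟨coord i x, fun _ => ⟨eq_piece hxo ▸ hxN, hx⟩⟩
    · exact ⟨o, fun h => absurd h ht⟩
  choose u hu using hex
  obtain ⟨U, hU, hfU⟩ := mapClusterPt_iff_ultrafilter.1 hy
  have hev : ∀ᶠ t in (U : Filter ℝ), (dist (coord i p) o)⁻¹ ≤ t :=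
    hU (eventually_ge_atTop _)
  refine hN.mem_of_tendsto (b := (U : Filter ℝ)) (tendsto_piece (u := u) ?_ ?_)
    (hev.mono fun t ht => (hu t ht).1)
  · rw [tendsto_iff_dist_tendsto_zero]
    exact (tendsto_inv_atTop_zero.mono_left hU).congr' (hev.mono fun t ht => (hu t ht).2.symm)
  · refine hfU.congr' (hev.mono fun t ht => ?_)
    simp only [spiral, (hu t ht).2, inv_inv]

section

variable {o : C} {f : ι → ℝ → Y} {F : ι → Set Y} [CompactSpace (Attach o (spiral o f))]
  [PreconnectedSpace C]

theorem isConnected_thick_univ (hF : ∀ i, IsClosed (F i)) (hFc : ∀ i, IsConnected (F i))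
    (hfF : ∀ i t, f i t ∈ F i) (i : ι) : IsConnected (thick o (spiral o f) i univ (F i)) :=
  isConnected_thick isClosed_univ (hF i) isPreconnected_univ (hFc i) trivial fun _ _ _ => hfF _ _

theorem preconnectedSpace_spiral [PreconnectedSpace Y] (hF : ∀ i, IsClosed (F i))
    (hFc : ∀ i, IsConnected (F i)) (hfF : ∀ i t, f i t ∈ F i) :
    PreconnectedSpace (Attach o (spiral o f)) := by
  have hY : IsPreconnected (range (incl o (spiral o f))) := isPreconnected_range continuous_incl
  refine ⟨?_⟩
  rcases isEmpty_or_nonempty Y with hY' | ⟨⟨y₀⟩⟩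
  · rintro U V _ _ _ ⟨x, _⟩
    exact isEmptyElim (base x)
  refine isPreconnected_of_forall (incl o (spiral o f) y₀) fun x _ => ?_
  rcases eq_incl_or_piece x with ⟨y, rfl⟩ | ⟨i, c, -, rfl⟩
  · exact ⟨_, subset_univ _, mem_range_self y₀, mem_range_self y, hY⟩
  · obtain ⟨y, hy⟩ := (hFc i).nonempty
    have hW : IsConnected (thick o (spiral o f) i univ (F i)) :=
      isConnected_thick_univ hF hFc hfF i
    have hyW : incl o (spiral o f) y ∈ thick o (spiral o f) i univ (F i) :=
      incl_mem_thick (mem_univ _) hy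
    have hcW : piece o (spiral o f) i c ∈ thick o (spiral o f) i univ (F i) :=
      piece_mem_thick (mem_univ _) (hfF i _)
    exact ⟨_, subset_univ _, Or.inl (mem_range_self y₀), Or.inr hcW,
      IsPreconnected.union _ (mem_range_self y) hyW hY hW.isPreconnected⟩

variable [CompactSpace C] [Nontrivial C] [Nontrivial ι]

/-- With a hereditarily indecomposable `C` and rays dense in the sets `F i`, a closed set which
blocks no point of its complement is contained in `Y` and misses all `F i`. Meeting `F i`, it would
trap all points of the `i`-th piece, by `incl_mem_of_exits`. If it missed `F i` but contained a
point at `c` of the `i`-th piece, take a continuum `D ∌ o` in `C` from `c` to a point `d` outside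
the trace of the set: a continuum leaving the piece from `d` projects to one containing `o` and `d`,
but not `c`, which is incomparable with `D`. -/
theorem subset_of_not_blocks (hC : HereditarilyIndecomposable C) (hF : ∀ i, IsClosed (F i))
    (hfF : ∀ i t, f i t ∈ F i) (hfcl : ∀ i, ∀ y ∈ F i, MapClusterPt y atTop (f i))
    {B : Set (Attach o (spiral o f))} (hB : IsClosed B) (hBne : B ≠ univ)
    (hnb : ∀ p ∈ Bᶜ, DoesNotBlock B p) : B ⊆ incl o (spiral o f) '' (⋃ i, F i)ᶜ := by
  obtain ⟨c₁, hc₁⟩ := exists_ne o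
  have hdense : Dense Bᶜ := by
    obtain ⟨p, hp⟩ := (ne_univ_iff_exists_notMem B).1 hBne
    exact (hnb p hp).mono (sUnion_subset fun K hK => hK.2.2.2)
  have hexit : ∀ i, ∀ p ∉ B, ∃ N : Set (Attach o (spiral o f)), IsClosed N ∧
      IsPreconnected N ∧ p ∈ N ∧ N ⊆ Bᶜ ∧ ∃ q ∈ N, coord i q = o := by
    intro i p hp
    obtain ⟨j, hj⟩ := exists_ne i
    obtain ⟨q, hqj, N, ⟨hN, hNc, hpN, hNB⟩, hqN⟩ :=
      (hnb p hp).inter_open_nonempty _ (isOpen_coord_ne j)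
      ⟨piece o (spiral o f) j c₁, by simpa using hc₁⟩
    exact ⟨N, hN, hNc.isPreconnected, hpN, hNB, q, hqN, (q.2 j hqj).2 i hj.symm⟩
  have hBF : ∀ i, ∀ y ∈ F i, incl o (spiral o f) y ∉ B := by
    intro i y hy hyB
    obtain ⟨p, hpi, hpB⟩ := hdense.inter_open_nonempty _ (isOpen_coord_ne i)
      ⟨piece o (spiral o f) i c₁, by simpa using hc₁⟩
    obtain ⟨N, hN, hNc, hpN, hNB, q, hqN, hq⟩ := hexit i p hpB
    exact hNB (incl_mem_of_exits hN hNc hpN hqN hpi hq (hfcl i y hy)) hyB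
  intro x hx
  rcases eq_incl_or_piece x with ⟨y, rfl⟩ | ⟨i, c, hc, rfl⟩
  · refine ⟨y, fun hy => ?_, rfl⟩
    obtain ⟨i, hi⟩ := mem_iUnion.1 hy
    exact hBF i y hi hx
  exfalso
  -- The trace of `B` on the `i`-th piece is a closed subset of `C` missing `o`.
  let β : Set C := coord i '' (B ∩ thick o (spiral o f) i univ (F i))
  have hβ : IsClosed β :=
    (continuous_coord i).isClosedMap _ (hB.inter (isClosed_thick isClosed_univ (hF i)))
  have hoβ : o ∉ β := by
    rintro ⟨z, ⟨hzB, hzW⟩, hzo⟩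
    exact hBF i _ hzW.1 (eq_incl_of_mem_thick hzW hzo ▸ hzB)
  have hpβ : ∀ d, piece o (spiral o f) i d ∈ B → d ∈ β := fun d hd =>
    ⟨_, ⟨hd, piece_mem_thick (mem_univ _) (hfF i _)⟩, coord_piece_self i d⟩
  obtain ⟨T, hT, hTc, hTβ⟩ := exists_mem_nhds_isClosed_subset (hβ.isOpen_compl.mem_nhds hoβ)
  have hoV : o ∈ interior T := mem_interior_iff_mem_nhds.2 hT
  have hclV : closure (interior T) ⊆ βᶜ :=
    (closure_minimal interior_subset hTc).trans hTβ
  obtain ⟨D, hD, hDc, hcD, hDV, d, hdD, hdV⟩ := exists_isPreconnected_meets_closure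
    isOpen_interior ⟨o, hoV⟩ (fun h => hclV (subset_closure h) (hpβ c hx))
  have hoD : o ∉ D := fun h => Set.disjoint_left.1 hDV h hoV
  have hdB : piece o (spiral o f) i d ∉ B := fun h => hclV hdV (hpβ d h)
  obtain ⟨N, hN, hNc, hpN, hNB, q, hqN, hq⟩ := hexit i _ hdB
  have hdM : d ∈ coord i '' N := ⟨_, hpN, coord_piece_self i d⟩
  rcases hC (coord i '' N) D ((continuous_coord i).isClosedMap _ hN) hD
    (hNc.image _ (continuous_coord i).continuousOn) hDc ⟨d, hdM, hdD⟩ with h | h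
  · exact hoD (h ⟨q, hqN, hq⟩)
  · obtain ⟨z, hzN, hz⟩ := h hcD
    have : z = piece o (spiral o f) i c :=
      eq_of_coord_eq (by rw [hz]; exact hc) (hz.trans (coord_piece_self i c).symm)
    exact hNB hzN (this ▸ hx)

end

end Attach

/-! ### Attaching lines -/

/-- A line whose right end accumulates on all of `R` and whose left end accumulates on all of `L`.
-/
theorem exists_line {Y : Type*} [TopologicalSpace Y] [SecondCountableTopology Y]
    [PathConnectedSpace Y] {L R : Set Y} (hL : IsPathConnected L) (hR : IsPathConnected R) :
    ∃ f : ℝ → Y, Continuous f ∧ (∀ t, 0 ≤ t → f t ∈ R) ∧ (∀ t ≤ -1, f t ∈ L) ∧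
      (∀ y ∈ R, MapClusterPt y atTop f) ∧ ∀ y ∈ L, MapClusterPt y atBot f := by
  obtain ⟨u, hu, hucl⟩ := exists_seq_mapClusterPt hL.nonempty
  obtain ⟨v, hv, hvcl⟩ := exists_seq_mapClusterPt hR.nonempty
  let y : ℤ → Y := fun n => if 0 ≤ n then v n.toNat else u (-n).toNat
  let S : ℤ → Set Y := fun n => if 0 ≤ n then R else if n = -1 then univ else L
  obtain ⟨f, hf, hfy, hfS⟩ := exists_continuous_through y S fun n => by
    by_cases h : 0 ≤ n
    · simp only [y, S, h, show 0 ≤ n + 1 by omega, if_true]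
      exact hR.joinedIn _ (hv _) _ (hv _)
    · by_cases h1 : n = -1
      · simp only [S, h1, if_true]
        exact (pathConnectedSpace_iff_univ.1 inferInstance).joinedIn _ trivial _ trivial
      · simp only [y, S, h, h1, show ¬ 0 ≤ n + 1 by omega, if_false]
        exact hL.joinedIn _ (hu _) _ (hu _)
  refine ⟨f, hf, fun t ht => ?_, fun t ht => ?_, fun x hx => ?_, fun x hx => ?_⟩
  · have h := hfS ⌊t⌋ t (Int.floor_le t) (Int.lt_floor_add_one t).le
    simpa only [S, Int.floor_nonneg.2 ht, if_true] using h
  · have h := hfS (⌈t⌉ - 1) t (by push_cast; linarith [Int.ceil_lt_add_one t])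
      (by push_cast; linarith [Int.le_ceil t])
    have h1 : ⌈t⌉ ≤ -1 := Int.ceil_le.2 (by exact_mod_cast ht)
    simpa only [S, show ¬ 0 ≤ ⌈t⌉ - 1 by omega, show ¬ ⌈t⌉ - 1 = -1 by omega, if_false] using h
  · have he : v = f ∘ fun n : ℕ => (n : ℝ) := by
      funext n
      have := hfy n
      simpa [y] using this.symm
    have h := hvcl x hx
    rw [he] at h
    exact h.of_comp tendsto_natCast_atTop_atTop
  · have he : u =ᶠ[atTop] f ∘ fun n : ℕ => -(n : ℝ) := by
      filter_upwards [eventually_gt_atTop 0] with n hn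
      have := hfy (-n)
      push_cast at this
      simp [y, this, hn.ne']
    have h : MapClusterPt x atTop (f ∘ fun n : ℕ => -(n : ℝ)) := by
      have := hucl x hx
      rwa [MapClusterPt, map_congr he] at this
    exact h.of_comp (tendsto_neg_atTop_atBot.comp tendsto_natCast_atTop_atTop)

namespace OnePoint

theorem tendsto_coe_atTop : Tendsto ((↑) : ℝ → OnePoint ℝ) atTop (𝓝 ∞) :=
  tendsto_coe_infty.mono_left (by
    rw [coclosedCompact_eq_cocompact]; exact atTop_le_cocompact)

theorem tendsto_coe_atBot : Tendsto ((↑) : ℝ → OnePoint ℝ) atBot (𝓝 ∞) :=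
  tendsto_coe_infty.mono_left (by
    rw [coclosedCompact_eq_cocompact]; exact atBot_le_cocompact)

theorem metrizableSpace_real : MetrizableSpace (OnePoint ℝ) :=
  (onePointEquivSphereOfFinrankEq (ι := Fin 2) (V := ℝ) (by simp)).isEmbedding.metrizableSpace

theorem isClosed_insert_infty {S : Set ℝ} (hS : IsClosed S) :
    IsClosed (insert ∞ ((↑) '' S) : Set (OnePoint ℝ)) := by
  rw [isClosed_iff_of_mem (mem_insert _ _)]
  convert hS using 1
  ext t; simp

theorem isPreconnected_insert_infty {S : Set ℝ} (hS : IsPreconnected S) {l : Filter ℝ} [l.NeBot]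
    (hl : Tendsto ((↑) : ℝ → OnePoint ℝ) l (𝓝 ∞)) (hlS : ∀ᶠ t in l, t ∈ S) :
    IsPreconnected (insert ∞ ((↑) '' S) : Set (OnePoint ℝ)) :=
  (hS.image _ continuous_coe.continuousOn).subset_closure (subset_insert _ _)
    (insert_subset (mem_closure_of_tendsto hl (hlS.mono fun _ ht => mem_image_of_mem _ ht))
      subset_closure)

end OnePoint

namespace Attach

variable {ι Y : Type*}

/-- The attaching map of a line parametrized by `f i`; the value at infinity has no meaning. -/
def lineMap (f : ι → ℝ → Y) (i : ι) (c : OnePoint ℝ) : Y := c.elim (f i 0) (f i)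

/-- The point with parameter `t` of the `i`-th attached line. -/
noncomputable def linePt (f : ι → ℝ → Y) (i : ι) (t : ℝ) : Attach ∞ (lineMap f) :=
  piece ∞ (lineMap f) i t

@[simp] theorem coord_linePt (f : ι → ℝ → Y) (i : ι) (t : ℝ) : coord i (linePt f i t) = t :=
  coord_piece_self i _

theorem linePt_ne_incl (f : ι → ℝ → Y) (i : ι) (t : ℝ) (y : Y) :
    linePt f i t ≠ incl ∞ (lineMap f) y := fun h =>
  OnePoint.coe_ne_infty t (by rw [← coord_linePt f i t, h]; rfl)

theorem eq_incl_or_linePt {f : ι → ℝ → Y} (x : Attach ∞ (lineMap f)) :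
    (∃ y, x = incl ∞ (lineMap f) y) ∨ ∃ i t, x = linePt f i t := by
  rcases eq_incl_or_piece x with h | ⟨i, c, hc, rfl⟩
  · exact Or.inl h
  · obtain ⟨t, rfl⟩ := OnePoint.ne_infty_iff_exists.1 hc
    exact Or.inr ⟨i, t, rfl⟩

variable [TopologicalSpace Y]

theorem continuousOn_lineMap {f : ι → ℝ → Y} (hf : ∀ i, Continuous (f i)) (i : ι) :
    ContinuousOn (lineMap f i) {∞}ᶜ := by
  intro c hc
  obtain ⟨t, rfl⟩ := OnePoint.ne_infty_iff_exists.1 hc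
  have h : ContinuousAt (lineMap f i ∘ ((↑) : ℝ → OnePoint ℝ)) t := (hf i).continuousAt
  exact (OnePoint.continuousAt_coe.2 h).continuousWithinAt

theorem continuous_linePt {f : ι → ℝ → Y} (hf : ∀ i, Continuous (f i)) (i : ι) :
    Continuous (linePt f i) :=
  (continuousOn_piece (continuousOn_lineMap hf) i).comp_continuous OnePoint.continuous_coe
    fun t => OnePoint.coe_ne_infty t

/-- A continuum which leaves an attached line contains one of the two rays cut off by any of its
points on that line. -/
theorem ray_subset_of_exits {f : ι → ℝ → Y} {i : ι} {N : Set (Attach ∞ (lineMap f))}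
    (hNc : IsPreconnected N) {t₀ : ℝ} (hp : linePt f i t₀ ∈ N) {q : Attach ∞ (lineMap f)}
    (hq : q ∈ N) (hqo : coord i q = ∞) :
    (∀ t, t₀ ≤ t → linePt f i t ∈ N) ∨ ∀ t ≤ t₀, linePt f i t ∈ N := by
  by_contra! hcon
  obtain ⟨⟨b, hb, hbN⟩, a, ha, haN⟩ := hcon
  have hM := hNc.image (coord i) (continuous_coord i).continuousOn
  have hmem : ∀ t : ℝ, (t : OnePoint ℝ) ∈ coord i '' N → linePt f i t ∈ N := by
    rintro t ⟨x, hx, hxt⟩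
    have : x = linePt f i t := eq_of_coord_eq (i := i)
      (by rw [hxt]; exact OnePoint.coe_ne_infty t) (by simp [hxt])
    exact this ▸ hx
  have hne : t₀ ≠ a ∧ t₀ ≠ b := ⟨by rintro rfl; exact haN hp, by rintro rfl; exact hbN hp⟩
  obtain ⟨c, -, ⟨t, ht, rfl⟩, hc⟩ := hM ((↑) '' Ioo a b) ((↑) '' Icc a b)ᶜ
    (OnePoint.isOpen_image_coe.2 isOpen_Ioo)
    (OnePoint.isOpen_compl_image_coe.2 ⟨isClosed_Icc, isCompact_Icc⟩)
    (fun c hc => by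
      by_contra hcon
      rw [mem_union, not_or, mem_compl_iff, not_not] at hcon
      obtain ⟨hc1, t, ht, rfl⟩ := hcon
      rcases ht.1.eq_or_lt with rfl | h1
      · exact haN (hmem _ hc)
      rcases ht.2.eq_or_lt with rfl | h2
      · exact hbN (hmem _ hc)
      exact hc1 ⟨t, ⟨h1, h2⟩, rfl⟩)
    ⟨t₀, ⟨_, hp, coord_linePt f i t₀⟩, t₀, ⟨ha.lt_of_ne hne.1.symm, hb.lt_of_ne hne.2⟩, rfl⟩
    ⟨∞, ⟨q, hq, hqo⟩, by rw [mem_compl_iff]; exact OnePoint.infty_notMem_image_coe⟩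
  exact hc ⟨t, Ioo_subset_Icc_self ht, rfl⟩

theorem incl_mem_of_mapClusterPt {f : ι → ℝ → Y} {i : ι} {N : Set (Attach ∞ (lineMap f))}
    (hN : IsClosed N) {l : Filter ℝ} (hl : Tendsto ((↑) : ℝ → OnePoint ℝ) l (𝓝 ∞))
    (hlN : ∀ᶠ t in l, linePt f i t ∈ N) {y : Y} (hy : MapClusterPt y l (f i)) :
    incl ∞ (lineMap f) y ∈ N := by
  obtain ⟨U, hU, hfU⟩ := mapClusterPt_iff_ultrafilter.1 hy
  exact hN.mem_of_tendsto (b := (U : Filter ℝ)) (tendsto_piece (hl.mono_left hU) hfU) (hU hlN)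

/-- A continuum which leaves an attached line contains everything on which one of its ends
accumulates. -/
theorem incl_subset_of_exits {f : ι → ℝ → Y} {i : ι} {N : Set (Attach ∞ (lineMap f))}
    (hN : IsClosed N) (hNc : IsPreconnected N) {t₀ : ℝ} (hp : linePt f i t₀ ∈ N)
    {q : Attach ∞ (lineMap f)} (hq : q ∈ N) (hqo : coord i q = ∞) {L R : Set Y}
    (hL : ∀ y ∈ L, MapClusterPt y atBot (f i)) (hR : ∀ y ∈ R, MapClusterPt y atTop (f i)) :
    incl ∞ (lineMap f) '' L ⊆ N ∨ incl ∞ (lineMap f) '' R ⊆ N := by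
  rcases ray_subset_of_exits hNc hp hq hqo with h | h
  · refine Or.inr (image_subset_iff.2 fun y hy => incl_mem_of_mapClusterPt hN
      OnePoint.tendsto_coe_atTop ?_ (hR y hy))
    filter_upwards [eventually_ge_atTop t₀] with t ht using h t ht
  · refine Or.inl (image_subset_iff.2 fun y hy => incl_mem_of_mapClusterPt hN
      OnePoint.tendsto_coe_atBot ?_ (hL y hy))
    filter_upwards [eventually_le_atBot t₀] with t ht using h t ht

/-- The end `S` of an attached line, together with the set `R` which contains the end's projection
and with an arc `T` of the line, is a continuum. -/
theorem exists_continuum_of_end [T2Space Y] {f : ι → ℝ → Y} (hf : ∀ i, Continuous (f i))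
    [CompactSpace (Attach ∞ (lineMap f))] {i : ι}
    {S T : Set ℝ} (hS : IsClosed S) (hSc : IsPreconnected S) (hT : IsCompact T)
    (hTc : IsPreconnected T) (hST : (S ∩ T).Nonempty) {l : Filter ℝ} [l.NeBot]
    (hl : Tendsto ((↑) : ℝ → OnePoint ℝ) l (𝓝 ∞)) (hlS : ∀ᶠ t in l, t ∈ S) {R : Set Y}
    (hR : IsClosed R) (hRc : IsConnected R) (hfR : ∀ t ∈ S, f i t ∈ R) :
    ∃ N : Set (Attach ∞ (lineMap f)), IsClosed N ∧ IsPreconnected N ∧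
      (∀ y, incl ∞ (lineMap f) y ∈ N ↔ y ∈ R) ∧ ∀ t ∈ T, linePt f i t ∈ N := by
  have hM := OnePoint.isClosed_insert_infty hS
  have hW : IsConnected (thick ∞ (lineMap f) i (insert ∞ ((↑) '' S)) R) :=
    isConnected_thick hM hR (OnePoint.isPreconnected_insert_infty hSc hl hlS) hRc
      (mem_insert _ _) (by
        rintro c (rfl | ⟨t, ht, rfl⟩) hc
        · exact absurd rfl hc
        · exact hfR t ht)
  obtain ⟨s, hsS, hsT⟩ := hST
  have hsW : linePt f i s ∈ thick ∞ (lineMap f) i (insert ∞ ((↑) '' S)) R :=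
    piece_mem_thick (Or.inr ⟨s, hsS, rfl⟩) (hfR s hsS)
  have hg := continuous_linePt hf i
  refine ⟨_, (isClosed_thick hM hR).union (hT.image hg).isClosed,
    IsPreconnected.union _ hsW (mem_image_of_mem _ hsT) hW.isPreconnected
      (hTc.image _ hg.continuousOn),
    fun y => ⟨?_, fun hy => Or.inl (incl_mem_thick (mem_insert _ _) hy)⟩,
    fun t ht => Or.inr (mem_image_of_mem _ ht)⟩
  rintro (h | ⟨t, -, h⟩)
  · exact h.1
  · exact absurd h (linePt_ne_incl f i t y)

end Attach

/-! ### The cube with lines -/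

/-- The Hilbert cube with a distinguished first coordinate, the height. -/
abbrev Cube : Type := I × (ℕ → I)

namespace Cube

instance : PathConnectedSpace I :=
  isPathConnected_iff_pathConnectedSpace.1
    ((convex_Icc (0 : ℝ) 1).isPathConnected ⟨0, unitInterval.zero_mem⟩)

/-- A half of the cube, cut off by the `k`-th coordinate. -/
def lower (k : ℕ) (a : I) : Set Cube := {x | x.2 k ≤ a}

/-- The opposite half of the cube. -/
def upper (k : ℕ) (a : I) : Set Cube := {x | a ≤ x.2 k}

theorem isClosed_lower (k : ℕ) (a : I) : IsClosed (lower k a) :=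
  isClosed_le (by fun_prop) continuous_const

theorem isClosed_upper (k : ℕ) (a : I) : IsClosed (upper k a) :=
  isClosed_le continuous_const (by fun_prop)

theorem isPathConnected_lower (k : ℕ) (a : I) : IsPathConnected (lower k a) := by
  have hf : Continuous fun x : Cube => (x.1, Function.update x.2 k (min (x.2 k) a)) := by
    refine continuous_fst.prodMk (continuous_snd.update k ?_)
    fun_prop
  convert isPathConnected_range hf using 1
  ext x
  constructor
  · intro hx
    refine ⟨x, Prod.ext rfl ?_⟩
    have : min (x.2 k) a = x.2 k := min_eq_left hx
    simp [this]
  · rintro ⟨y, rfl⟩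
    simp [lower]

theorem isPathConnected_upper (k : ℕ) (a : I) : IsPathConnected (upper k a) := by
  have hf : Continuous fun x : Cube => (x.1, Function.update x.2 k (max (x.2 k) a)) := by
    refine continuous_fst.prodMk (continuous_snd.update k ?_)
    fun_prop
  convert isPathConnected_range hf using 1
  ext x
  constructor
  · intro hx
    refine ⟨x, Prod.ext rfl ?_⟩
    have : max (x.2 k) a = x.2 k := max_eq_left hx
    simp [this]
  · rintro ⟨y, rfl⟩
    simp [upper]

/-- The face of height `1`. -/
def top : Set Cube := {x | x.1 = 1}

theorem isClosed_top : IsClosed top := isClosed_eq continuous_fst continuous_const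

theorem isPreconnected_top : IsPreconnected top := by
  have hf : Continuous fun v : ℕ → I => ((1, v) : Cube) := by fun_prop
  convert isPreconnected_range hf using 1
  ext x
  constructor
  · intro hx
    exact ⟨x.2, Prod.ext hx.symm rfl⟩
  · rintro ⟨y, rfl⟩
    rfl

/-- The points of height at least `c`, and those above `E`. The upper slab makes the set
path-connected for arbitrary `E`. -/
def slabUnion (c : I) (E : Set (ℕ → I)) : Set Cube := {x | c ≤ x.1 ∨ x.2 ∈ E}

theorem isClosed_slabUnion (c : I) {E : Set (ℕ → I)} (hE : IsClosed E) :
    IsClosed (slabUnion c E) :=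
  (isClosed_le continuous_const continuous_fst).union (hE.preimage continuous_snd)

theorem isPathConnected_slabUnion (c : I) (E : Set (ℕ → I)) :
    IsPathConnected (slabUnion c E) := by
  have hs : IsPathConnected {x : Cube | c ≤ x.1} := by
    have hf : Continuous fun x : Cube => (max c x.1, x.2) := by fun_prop
    convert isPathConnected_range hf using 1
    ext x
    constructor
    · intro hx
      exact ⟨x, Prod.ext (max_eq_right hx) rfl⟩
    · rintro ⟨y, rfl⟩
      simp
  refine ⟨(1, fun _ => 0), Or.inl unitInterval.le_one', ?_⟩
  have htop : ∀ v, JoinedIn (slabUnion c E) (1, fun _ => 0) (1, v) := fun v =>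
    (hs.joinedIn _ unitInterval.le_one' _ unitInterval.le_one').mono fun x hx => Or.inl hx
  rintro ⟨h, v⟩ (hx | hx)
  · exact (hs.joinedIn _ unitInterval.le_one' _ hx).mono fun x hx => Or.inl hx
  · have hf : Continuous fun h : I => ((h, v) : Cube) := by fun_prop
    refine (htop v).trans (((isPathConnected_range hf).joinedIn _ ⟨1, rfl⟩ _ ⟨h, rfl⟩).mono ?_)
    rintro _ ⟨h', rfl⟩
    exact Or.inr hx

/-- A vertical segment upwards, together with the top face, avoids any given other point of the
bottom. -/
theorem exists_continuum_avoiding (z : ℕ → I) {y : Cube} (hy : y ≠ (0, z)) :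
    ∃ N : Set Cube, IsClosed N ∧ IsPreconnected N ∧ y ∈ N ∧ top ⊆ N ∧ ((0, z) : Cube) ∉ N := by
  have hf : Continuous fun h : I => ((max h y.1, y.2) : Cube) := by fun_prop
  refine ⟨range (fun h : I => ((max h y.1, y.2) : Cube)) ∪ top,
    (isCompact_range hf).isClosed.union isClosed_top,
    IsPreconnected.union (1, y.2) ⟨1, Prod.ext (max_eq_left unitInterval.le_one') rfl⟩ rfl
      (isPreconnected_range hf) isPreconnected_top,
    Or.inl ⟨0, Prod.ext (max_eq_right unitInterval.nonneg') rfl⟩, subset_union_right, ?_⟩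
  rintro (⟨h, hh⟩ | h)
  · have h1 : max h y.1 = 0 := congrArg Prod.fst hh
    have h2 : y.1 ≤ 0 := h1 ▸ le_max_right _ _
    have h3 : y.2 = z := congrArg Prod.snd hh
    exact hy (Prod.ext (le_antisymm h2 unitInterval.nonneg') h3)
  · exact zero_ne_one (α := I) h

/-- Index set of the lines to be attached to the cube: a coordinate and two thresholds for it. -/
abbrev LineIndex : Type :=
  {q : ℕ × ℕ × ℕ // denseSeq I q.2.1 < denseSeq I q.2.2}

/-- The half of the cube on which the left end of the line accumulates. -/
def leftEnd (q : LineIndex) : Set Cube := lower q.1.1 (denseSeq I q.1.2.1)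

/-- The half of the cube on which the right end of the line accumulates. -/
def rightEnd (q : LineIndex) : Set Cube := upper q.1.1 (denseSeq I q.1.2.2)

theorem disjoint_ends (q : LineIndex) : Disjoint (leftEnd q) (rightEnd q) := by
  rw [Set.disjoint_left]
  intro x hx hx'
  exact (hx'.trans hx).not_gt q.2

theorem exists_separating_index {v w : ℕ → I} (h : v ≠ w) : ∃ q : LineIndex, ∀ s t : I,
    ((s, v) : Cube) ∈ leftEnd q ∧ ((t, w) : Cube) ∈ rightEnd q ∨
      ((t, w) : Cube) ∈ leftEnd q ∧ ((s, v) : Cube) ∈ rightEnd q := by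
  obtain ⟨k, hk⟩ := Function.ne_iff.1 h
  have key : ∀ a b : I, a < b → ∃ m n, denseSeq I m < denseSeq I n ∧ a ≤ denseSeq I m ∧
      denseSeq I n ≤ b := by
    intro a b hab
    obtain ⟨_, ⟨m, rfl⟩, h1, h2⟩ := (denseRange_denseSeq I).exists_between hab
    obtain ⟨_, ⟨n, rfl⟩, h3, h4⟩ := (denseRange_denseSeq I).exists_between h2
    exact ⟨m, n, h3, h1.le, h4.le⟩
  rcases hk.lt_or_gt with hlt | hlt
  · obtain ⟨m, n, h1, h2, h3⟩ := key _ _ hlt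
    exact ⟨⟨(k, m, n), h1⟩, fun s t => Or.inl ⟨h2, h3⟩⟩
  · obtain ⟨m, n, h1, h2, h3⟩ := key _ _ hlt
    exact ⟨⟨(k, m, n), h1⟩, fun s t => Or.inr ⟨h2, h3⟩⟩

end Cube

open Attach Cube

/-- The cube with lines attached to it, their ends accumulating on the pairs of halves `leftEnd q`,
`rightEnd q`. It contains a copy `j '' D` of `D` on the bottom face, whose complement is the union
of countably many path-connected closed sets `F i`. For two points of `D` there are a point `p` on one
of the lines and a set `F i` off that line such that every continuum from `p` to `F i` contains one of
the two; but all points other than a single point of `D` can be joined to a fixed point `t` in its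
complement. -/
theorem exists_base_continuum {D : Set (ℕ → I)} (hD : IsGδ D) :
    ∃ (Y : Type) (_ : TopologicalSpace Y) (_ : CompactSpace Y) (_ : MetrizableSpace Y)
      (_ : ConnectedSpace Y) (j : (ℕ → I) → Y) (κ : Type) (_ : Countable κ) (_ : Nontrivial κ)
      (F : κ → Set Y), IsEmbedding j ∧ (∀ i, IsClosed (F i)) ∧ (∀ i, IsPathConnected (F i)) ∧
      (⋃ i, F i)ᶜ = j '' D ∧
      (∀ v ∈ D, ∀ w ∈ D, v ≠ w → ∃ p i, p ∈ (⋃ i, F i) ∧ ∀ N, IsClosed N → IsPreconnected N →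
        p ∈ N → (N ∩ F i).Nonempty → j v ∈ N ∨ j w ∈ N) ∧
      ∃ t, ∀ v, ∀ y ≠ j v, ∃ N, IsClosed N ∧ IsPreconnected N ∧ y ∈ N ∧ t ∈ N ∧ j v ∉ N := by
  have hex : ∀ q : LineIndex, ∃ f : ℝ → Cube, Continuous f ∧ (∀ t, 0 ≤ t → f t ∈ rightEnd q) ∧
      (∀ t ≤ -1, f t ∈ leftEnd q) ∧ (∀ y ∈ rightEnd q, MapClusterPt y atTop f) ∧
      ∀ y ∈ leftEnd q, MapClusterPt y atBot f := fun q =>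
    exists_line (isPathConnected_lower _ _) (isPathConnected_upper _ _)
  choose f hf hfR hfL hclR hclL using hex
  have hOP : MetrizableSpace (OnePoint ℝ) := OnePoint.metrizableSpace_real
  have hcomp : CompactSpace (Attach ∞ (lineMap f)) := compactSpace (continuousOn_lineMap hf)
  -- Every point is joined to the top of the cube, avoiding a given point of the bottom: a line is
  -- left through the end whose half of the cube does not contain the given point.
  have hjoin : ∀ (v : ℕ → I) (y : Attach ∞ (lineMap f)), y ≠ incl ∞ (lineMap f) (0, v) →
      ∃ N, IsClosed N ∧ IsPreconnected N ∧ y ∈ N ∧ incl ∞ (lineMap f) (1, fun _ => 0) ∈ N ∧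
        incl ∞ (lineMap f) (0, v) ∉ N := by
    intro v y hy
    have himg : ∀ S : Set Cube, IsClosed S → IsClosed (incl ∞ (lineMap f) '' S) := fun S hS =>
      continuous_incl.isClosedMap S hS
    have himg' : ∀ S : Set Cube, IsPreconnected S → IsPreconnected (incl ∞ (lineMap f) '' S) :=
      fun S hS => hS.image _ continuous_incl.continuousOn
    rcases eq_incl_or_linePt y with ⟨x, rfl⟩ | ⟨q, t, rfl⟩
    · obtain ⟨N, h1, h2, h3, h4, h5⟩ := Cube.exists_continuum_avoiding v
        (fun h => hy (congrArg _ h) : x ≠ (0, v))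
      exact ⟨_, himg N h1, himg' N h2, mem_image_of_mem _ h3, mem_image_of_mem _ (h4 rfl),
        fun h => h5 (incl_injective.mem_set_image.1 h)⟩
    · have key : ∀ N : Set (Attach ∞ (lineMap f)), ∀ R : Set Cube, IsClosed N → IsPreconnected N →
          (∀ y, incl ∞ (lineMap f) y ∈ N ↔ y ∈ R) → linePt f q t ∈ N → (R ∩ top).Nonempty →
          ((0, v) : Cube) ∉ R → ∃ N, IsClosed N ∧ IsPreconnected N ∧ linePt f q t ∈ N ∧
            incl ∞ (lineMap f) (1, fun _ => 0) ∈ N ∧ incl ∞ (lineMap f) (0, v) ∉ N := by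
        rintro N R h1 h2 h3 h4 ⟨w, hwR, hw⟩ h5
        refine ⟨N ∪ incl ∞ (lineMap f) '' top, h1.union (himg _ isClosed_top),
          IsPreconnected.union _ ((h3 w).2 hwR) (mem_image_of_mem _ hw) h2
            (himg' _ isPreconnected_top), Or.inl h4, Or.inr (mem_image_of_mem _ rfl), ?_⟩
        rintro (h | h)
        · exact h5 ((h3 _).1 h)
        · obtain ⟨x, hx, hxv⟩ := h
          obtain rfl := incl_injective hxv
          exact zero_ne_one (α := I) hx
      by_cases hv : ((0, v) : Cube) ∈ rightEnd q
      · obtain ⟨N, h1, h2, h3, h4⟩ := exists_continuum_of_end hf (i := q) (S := Iic (-1))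
          (T := uIcc t (-1)) isClosed_Iic isPreconnected_Iic isCompact_uIcc isPreconnected_uIcc
          ⟨-1, self_mem_Iic, right_mem_uIcc⟩ OnePoint.tendsto_coe_atBot (eventually_le_atBot _)
          (isClosed_lower _ _) (isPathConnected_lower _ _).isConnected (hfL q)
        exact key N _ h1 h2 h3 (h4 t left_mem_uIcc)
          ⟨(1, fun _ => 0), unitInterval.nonneg', rfl⟩
          fun h => Set.disjoint_left.1 (disjoint_ends q) h hv
      · obtain ⟨N, h1, h2, h3, h4⟩ := exists_continuum_of_end hf (i := q) (S := Ici 0)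
          (T := uIcc t 0) isClosed_Ici isPreconnected_Ici isCompact_uIcc isPreconnected_uIcc
          ⟨0, self_mem_Ici, right_mem_uIcc⟩ OnePoint.tendsto_coe_atTop (eventually_ge_atTop _)
          (isClosed_upper _ _) (isPathConnected_upper _ _).isConnected (hfR q)
        exact key N _ h1 h2 h3 (h4 t left_mem_uIcc) ⟨(1, fun _ => 1), unitInterval.le_one', rfl⟩ hv
  have hconn : ConnectedSpace (Attach ∞ (lineMap f)) := by
    have : Nonempty (Attach ∞ (lineMap f)) := ⟨incl ∞ (lineMap f) (1, fun _ => 0)⟩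
    have : PreconnectedSpace (Attach ∞ (lineMap f)) := by
      refine ⟨isPreconnected_of_forall (incl ∞ (lineMap f) (1, fun _ => 0)) fun y _ => ?_⟩
      by_cases hy : y = incl ∞ (lineMap f) (0, fun _ => 0)
      · exact ⟨_, subset_univ _, mem_range_self _, hy ▸ mem_range_self _,
          isPreconnected_range continuous_incl⟩
      · obtain ⟨N, -, h2, h3, h4, -⟩ := hjoin _ y hy
        exact ⟨N, subset_univ _, h4, h3, h2⟩
    exact { toNonempty := ‹_› }
  obtain ⟨O, hO, rfl⟩ := isGδ_iff_eq_iInter_nat.1 hD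
  let c : ℕ → I := fun n => ⟨1 / ((n : ℝ) + 1), by positivity, by
    rw [div_le_one (by positivity)]; linarith [n.cast_nonneg (α := ℝ)]⟩
  let F : ℕ ⊕ (LineIndex × ℤ) → Set (Attach ∞ (lineMap f)) :=
    Sum.elim (fun n => incl ∞ (lineMap f) '' slabUnion (c n) (O n)ᶜ)
      (fun r => linePt f r.1 '' Icc (r.2 : ℝ) (r.2 + 1))
  have hline : ∀ q t, linePt f q t ∈ ⋃ i, F i := fun q t => mem_iUnion.2 ⟨Sum.inr (q, ⌊t⌋),
    t, ⟨Int.floor_le t, (Int.lt_floor_add_one t).le⟩, rfl⟩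
  refine ⟨Attach ∞ (lineMap f), inferInstance, hcomp, inferInstance, hconn,
    fun v => incl ∞ (lineMap f) (0, v), ℕ ⊕ (LineIndex × ℤ), inferInstance,
    ⟨Sum.inl 0, Sum.inl 1, by simp⟩, F, ?_, ?_, ?_, ?_, ?_, _, hjoin⟩
  · refine IsClosedEmbedding.isEmbedding (Continuous.isClosedEmbedding ?_ ?_)
    · exact continuous_incl.comp (by fun_prop)
    · intro v w h
      exact congrArg Prod.snd (incl_injective h)
  · rintro (n | r)
    · exact continuous_incl.isClosedMap _ (isClosed_slabUnion _ (hO n).isClosed_compl)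
    · exact (isCompact_Icc.image (continuous_linePt hf r.1)).isClosed
  · rintro (n | r)
    · exact (isPathConnected_slabUnion _ _).image continuous_incl
    · exact ((convex_Icc _ _).isPathConnected ⟨_, left_mem_Icc.2 (by linarith)⟩).image
        (continuous_linePt hf r.1)
  · ext y
    constructor
    · intro hy
      rcases eq_incl_or_linePt y with ⟨⟨h, v⟩, rfl⟩ | ⟨q, t, rfl⟩
      · have hn : ∀ n, ¬ (c n ≤ h ∨ v ∉ O n) := fun n hn =>
          hy (mem_iUnion.2 ⟨Sum.inl n, _, hn, rfl⟩)
        push Not at hn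
        refine ⟨v, mem_iInter.2 fun n => (hn n).2, ?_⟩
        have h0 : h = 0 := by
          by_contra hne
          have hpos : (0 : ℝ) < h := lt_of_le_of_ne h.2.1 fun h' => hne (Subtype.ext h'.symm)
          obtain ⟨n, hn'⟩ := exists_nat_one_div_lt hpos
          exact (hn n).1.not_gt hn'
        rw [h0]
      · exact absurd (hline q t) hy
    · rintro ⟨v, hv, rfl⟩ hy
      obtain ⟨n | r, hi⟩ := mem_iUnion.1 hy
      · obtain hx | hx := incl_injective.mem_set_image.1 hi
        · have : (0 : ℝ) < c n := by simp only [c]; positivity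
          exact (this.trans_le hx).false
        · exact hx (mem_iInter.1 hv n)
      · obtain ⟨t, -, ht⟩ := hi
        exact linePt_ne_incl f r.1 t _ ht
  · intro v _ w _ hvw
    obtain ⟨q, hq⟩ := exists_separating_index hvw
    refine ⟨linePt f q 0, Sum.inl 0, hline q 0, fun N hN hNc hp ⟨y, hyN, x, _, hxy⟩ => ?_⟩
    have h := incl_subset_of_exits hN hNc hp hyN (by rw [← hxy]; rfl) (hclL q) (hclR q)
    rcases hq 0 0 with ⟨h1, h2⟩ | ⟨h1, h2⟩
    · exact h.imp (fun h => h (mem_image_of_mem _ h1)) fun h => h (mem_image_of_mem _ h2)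
    · exact h.symm.imp (fun h => h (mem_image_of_mem _ h2)) fun h => h (mem_image_of_mem _ h1)

/-! ### The continuum -/

open Attach

/-- A point does not block if all other points can be joined to a fixed point `t` in its complement.
-/
theorem doesNotBlock_singleton {X : Type*} [TopologicalSpace X] [T1Space X] [ConnectedSpace X]
    [Nontrivial X] {x t : X} (h : ∀ p ≠ x, ∃ N, IsClosed N ∧ IsPreconnected N ∧ p ∈ N ∧ t ∈ N ∧
      x ∉ N) {p : X} (hp : p ≠ x) : DoesNotBlock {x} p := by
  refine (dense_compl_singleton x).mono fun q hq => ?_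
  obtain ⟨N, h1, h2, h3, h4, h5⟩ := h p hp
  obtain ⟨M, k1, k2, k3, k4, k5⟩ := h q hq
  exact ⟨N ∪ M, ⟨h1.union k1, ⟨⟨p, Or.inl h3⟩, IsPreconnected.union t h4 k4 h2 k2⟩, Or.inl h3,
    subset_compl_singleton_iff.2 fun hx => hx.elim h5 k5⟩, Or.inr k3⟩

/-- A continuum in which the closed sets that block no point of their complement are the singletons
of the points of a copy of `D`. -/
theorem exists_continuum_nonBlockers {D : Set (ℕ → unitInterval)} (hD : IsGδ D) :
    ∃ (X : Type) (_ : TopologicalSpace X) (_ : CompactSpace X) (_ : MetrizableSpace X)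
      (_ : ConnectedSpace X) (_ : Nontrivial X) (e : (ℕ → unitInterval) → X), IsEmbedding e ∧
      ∀ B : Set X, IsClosed B → B.Nonempty →
        ((B ≠ univ ∧ ∀ p ∈ Bᶜ, DoesNotBlock B p) ↔ ∃ v ∈ D, B = {e v}) := by
  obtain ⟨Y, _, _, _, _, j, κ, _, _, F, hj, hF, hFp, hFD, hsep, t₀, ht₀⟩ :=
    exists_base_continuum hD
  obtain ⟨K, hK, hKc, ⟨o', ho', o'', ho'', hne⟩, hKi⟩ := exists_hereditarilyIndecomposable
  let _ : MetricSpace Y := metrizableSpaceMetric Y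
  have : SecondCountableTopology Y := inferInstance
  choose f hf hfF hfcl using fun i => (hFp i).exists_ray
  let _ : MetricSpace K := metrizableSpaceMetric K
  have : CompactSpace K := isCompact_iff_compactSpace.1 hK
  have : PreconnectedSpace K := isPreconnected_iff_preconnectedSpace.1 hKc
  have : Nontrivial K := ⟨⟨o', ho'⟩, ⟨o'', ho''⟩, fun h => hne (congrArg Subtype.val h)⟩
  let o : K := ⟨o', ho'⟩
  have hcomp : CompactSpace (Attach o (spiral o f)) := compactSpace (continuousOn_spiral o hf)
  have hpre : PreconnectedSpace (Attach o (spiral o f)) :=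
    preconnectedSpace_spiral hF (fun i => (hFp i).isConnected) hfF
  have hconn : ConnectedSpace (Attach o (spiral o f)) := { toNonempty := ⟨incl o _ t₀⟩ }
  obtain ⟨i₀⟩ : Nonempty κ := inferInstance
  obtain ⟨c, hc⟩ := exists_ne o
  have hnt : Nontrivial (Attach o (spiral o f)) :=
    ⟨incl o _ t₀, piece o _ i₀ c, fun h => hc (by rw [← coord_piece_self i₀ c, ← h]; rfl)⟩
  have hemb : IsEmbedding (incl o (spiral o f)) :=
    (continuous_incl.isClosedEmbedding incl_injective).isEmbedding
  have hbase : ∀ v ∈ D, ∀ x : Attach o (spiral o f), base x = j v →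
      x = incl o (spiral o f) (j v) := by
    intro v hv x hx
    rcases eq_incl_or_piece x with ⟨y, rfl⟩ | ⟨i, c, -, rfl⟩
    · exact congrArg _ hx
    · have h : j v ∈ (⋃ i, F i)ᶜ := hFD ▸ mem_image_of_mem j hv
      exact absurd (mem_iUnion.2 ⟨i, hx ▸ hfF i _⟩) h
  refine ⟨Attach o (spiral o f), inferInstance, hcomp, inferInstance, hconn, hnt,
    fun v => incl o (spiral o f) (j v), hemb.comp hj, fun B hB hBne => ⟨?_, ?_⟩⟩
  · rintro ⟨hBu, hnb⟩
    have hsub := subset_of_not_blocks hKi hF hfF hfcl hB hBu hnb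
    rw [hFD, image_image] at hsub
    obtain ⟨b, hb⟩ := hBne
    obtain ⟨v, hv, rfl⟩ := hsub hb
    refine ⟨v, hv, subset_antisymm (fun b' hb' => ?_) (singleton_subset_iff.2 hb)⟩
    obtain ⟨w, hw, rfl⟩ := hsub hb'
    by_contra hne'
    have hvw : v ≠ w := by rintro rfl; exact hne' rfl
    obtain ⟨p, i, hp, hpN⟩ := hsep v hv w hw hvw
    have hpB : incl o (spiral o f) p ∈ Bᶜ := by
      intro h
      obtain ⟨u, hu, hup⟩ := hsub h
      have h1 : p ∈ (⋃ i, F i)ᶜ := hFD ▸ ⟨u, hu, incl_injective hup⟩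
      exact h1 hp
    obtain ⟨q, hq, N, ⟨hN, hNc, hpN', hNB⟩, hqN⟩ :=
      (hnb _ hpB).inter_open_nonempty _ (isOpen_coord_ne i)
      ⟨piece o (spiral o f) i c, by simpa using hc⟩
    have hqF : base q ∈ F i := by
      rw [show base q = spiral o f i (coord i q) from (q.2 i hq).1]
      exact hfF i _
    rcases hpN (base '' N) (continuous_base.isClosedMap _ hN)
      (hNc.isPreconnected.image _ continuous_base.continuousOn) ⟨_, hpN', rfl⟩
      ⟨_, ⟨q, hqN, rfl⟩, hqF⟩ with ⟨x, hxN, hx⟩ | ⟨x, hxN, hx⟩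
    · exact hNB hxN (hbase v hv x hx ▸ hb)
    · exact hNB hxN (hbase w hw x hx ▸ hb')
  · rintro ⟨v, hv, rfl⟩
    refine ⟨fun h => ?_, fun p hp => doesNotBlock_singleton (t := incl o (spiral o f) t₀) ?_ hp⟩
    · obtain ⟨x, hx⟩ := exists_ne (incl o (spiral o f) (j v))
      exact hx (h ▸ mem_univ x : x ∈ ({incl o (spiral o f) (j v)} : Set _))
    have hY : ∀ y, y ≠ j v → ∃ N : Set (Attach o (spiral o f)), IsClosed N ∧ IsPreconnected N ∧
        incl o (spiral o f) y ∈ N ∧ incl o (spiral o f) t₀ ∈ N ∧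
        incl o (spiral o f) (j v) ∉ N := by
      intro y hy
      obtain ⟨N, h1, h2, h3, h4, h5⟩ := ht₀ v y hy
      exact ⟨_, continuous_incl.isClosedMap _ h1, h2.image _ continuous_incl.continuousOn,
        mem_image_of_mem _ h3, mem_image_of_mem _ h4,
        fun h => h5 (incl_injective.mem_set_image.1 h)⟩
    intro x hx
    rcases eq_incl_or_piece x with ⟨y, rfl⟩ | ⟨i, d, -, rfl⟩
    · exact hY y fun h => hx (congrArg _ h)
    · obtain ⟨y, hy⟩ := (hFp i).nonempty
      have hv' : j v ∉ F i := fun h =>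
        (hFD ▸ mem_image_of_mem j hv : j v ∈ (⋃ i, F i)ᶜ) (mem_iUnion.2 ⟨i, h⟩)
      obtain ⟨N, h1, h2, h3, h4, h5⟩ := hY y fun h => hv' (h ▸ hy)
      have hW : IsConnected (thick o (spiral o f) i univ (F i)) :=
        isConnected_thick_univ hF (fun i => (hFp i).isConnected) hfF i
      have hyW : incl o (spiral o f) y ∈ thick o (spiral o f) i univ (F i) :=
        incl_mem_thick (mem_univ _) hy
      exact ⟨thick o (spiral o f) i univ (F i) ∪ N, (isClosed_thick isClosed_univ (hF i)).union h1,
        IsPreconnected.union _ hyW h3 hW.isPreconnected h2,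
        Or.inl (piece_mem_thick (mem_univ _) (hfF i _)), Or.inr h4,
        fun h => h.elim (fun h => hv' h.1) h5⟩

theorem theorem1p1 (Z : Type*) [TopologicalSpace Z] [IsCompletelyMetrizableSpace Z]
    [SeparableSpace Z] :
    ∃ (X : Type) (_ : MetricSpace X) (_ : CompactSpace X) (_ : ConnectedSpace X)
      (_ : Nontrivial X), Nonempty (NonBlockers X ≃ₜ Z) := by
  let _ := upgradeIsCompletelyMetrizable Z
  obtain ⟨φ, hφ⟩ := Metric.PiNatEmbed.exists_embedding_to_hilbert_cube (X := Z)
  obtain ⟨X, _, _, _, _, _, e, he, hB⟩ := exists_continuum_nonBlockers hφ.isGδ_range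
  let _ : MetricSpace X := metrizableSpaceMetric X
  refine ⟨X, inferInstance, inferInstance, inferInstance, inferInstance, ?_⟩
  let ψ : Z → NonemptyCompacts X := fun z => {e (φ z)}
  have hψ : IsEmbedding ψ := NonemptyCompacts.isEmbedding_singleton.comp (he.comp hφ)
  have hrange : NonBlockers X = range ψ := by
    ext B
    refine (hB B B.isCompact.isClosed B.nonempty).trans ?_
    constructor
    · rintro ⟨_, ⟨z, rfl⟩, h⟩
      exact ⟨z, SetLike.coe_injective (by rw [h]; rfl)⟩
    · rintro ⟨z, rfl⟩
      exact ⟨_, ⟨z, rfl⟩, rfl⟩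
  exact ⟨(Homeomorph.setCongr hrange).trans hψ.toHomeomorph.symm⟩
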